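/- Theorem. A graph $G$ with $q$ edges is called $\Gamma$-harmonious, for an (additive) abelian group $\Gamma$ of order $q$, if there is an injection $f:V(G)\to\Gamma$ (a $\Gamma$-harmonious labeling) such that the induced edge labels $w(xy)=f(x)+f(y)$ form a bijection from $E(G)$ onto $\Gamma$. For integers $n\ge 3$ and $k\ge 0$ let the superwheel $SW_{k,n}$ be the graph obtained from the cycle $C_n$ by adding $k$ pairwise nonadjacent vertices (hubs), each adjacent to every vertex of $C_n$; it has $n(k+1)$ edges. Let $\Gamma$ be an abelian group of order $n(k+1)$ that has a subgroup $H$ of order $n$ such that either $n$ is odd, or $n$ is even and $H$ has a subgroup isomorphic to $\mathbb Z_2\oplus\mathbb Z_{2s}$ for some integer $s\ge 2$. Then $SW_{k,n}$ is $\Gamma$-harmonious. More precisely, there are an $H$-harmonious labeling $(h_1,\dots,h_n)$ of $C_n$ and elements $g_1,\dots,g_k\in\Gamma$ whose cosets $g_1+H,\dots,g_k+H$ are exactly the $k$ cosets of $H$ in $\Gamma$ other than $H$, each occurring once, such that labeling the cycle vertices by $h_1,\dots,h_n$ and the hubs by $g_1,\dots,g_k$ is a $\Gamma$-harmonious labeling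 of $SW_{k,n}$. -/

import Mathlib

/-- The label `f x + f y` that a vertex labeling `f` induces on the unordered pair `{x, y}`. -/
def edgeLabel {V Γ : Type*} [AddCommGroup Γ] (f : V → Γ) : Sym2 V → Γ :=
  Sym2.lift ⟨fun x y => f x + f y, fun x y => add_comm (f x) (f y)⟩

/-- `f` is a `Γ`-harmonious labeling of `G`: it is injective on vertices and the induced edge
labels form a bijection from the edge set of `G` onto `Γ` (so `Γ` has as many elements as `G`
has edges). -/
def IsHarmoniousLabeling {V Γ : Type*} [AddCommGroup Γ] (G : SimpleGraph V) (f : V → Γ) : Prop :=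
  Function.Injective f ∧ Set.BijOn (edgeLabel f) G.edgeSet Set.univ

/-- The graph `G` is `Γ`-harmonious. -/
def IsHarmonious {V : Type*} (G : SimpleGraph V) (Γ : Type*) [AddCommGroup Γ] : Prop :=
  ∃ f : V → Γ, IsHarmoniousLabeling G f

/-- The superwheel `SW_{k,n}`: the cycle `C_n` together with `k` pairwise nonadjacent hub
vertices, each adjacent to every vertex of the cycle. -/
def superwheel (k n : ℕ) : SimpleGraph (Fin n ⊕ Fin k) :=
  (SimpleGraph.cycleGraph n ⊕g (⊥ : SimpleGraph (Fin k))) ⊔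
    completeBipartiteGraph (Fin n) (Fin k)

/-- The condition on an abelian group `A` of order `n`: either `n` is odd, or `n` is even and
`A` has a subgroup isomorphic to `Z_2 ⊕ Z_{2s}` for some `s ≥ 2`. -/
def CycleCondition (A : Type*) [AddCommGroup A] (n : ℕ) : Prop :=
  Odd n ∨ (Even n ∧ ∃ s : ℕ, 2 ≤ s ∧ ∃ K : AddSubgroup A,
    Nonempty (K ≃+ ZMod 2 × ZMod (2 * s)))

/-!
An arrangement `h₁, …, hₙ` of `H` in a cycle whose consecutive sums run through `H` extends to the
superwheel for free: the edges at the hub labelled `g` receive all the labels in `g + H`. So the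
problem is to find such a cyclic arrangement, i.e. to show that `H` is harmonic.

A group is harmonic if it has a harmonic subgroup with quotient of odd order: one runs around the
quotient while zigzagging through the subgroup. As multiples of a generator show that cyclic groups
of odd order are harmonic, so are all groups of odd order. For even order it remains to treat the
kernel of the multiplication by a large power of two, or, if this is elementary abelian, its product
with a group of prime order.

Extensions by an elementary abelian `2`-group `F` of order at least `4` are handled by viewing `F`
as a field. Almost all of a lifted cycle consists of `|F| - 1` copies of the cycle of the quotient,
shifted in the `F`-direction by the powers of a generator of `Fˣ` times a proper colouring with
colours in `Fˣ`: sums of links of the quotient are then multiplied by these powers and so reach all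
nonzero elements of `F`. One more copy of the cycle gives the remaining elements, and a `Switch`, a
configuration of three links of the quotient which is inherited by the lifted cycle, lets one join
the copies. Iterating this reduces every group to `ZMod n` with `n` odd, to `ZMod 2 × ZMod (2 ^ n)`,
for which a switch is obtained by doubling, and to a few small groups.
-/

/-- A finite abelian group is harmonic if its elements can be arranged in a cycle whose consecutive
sums run through the whole group. The cycle is encoded as a periodic sequence; since the period is
the order of the group, surjectivity says that every element, and every sum, occurs exactly once
per period. -/
def Harmonic (A : Type*) [AddCommGroup A] : Prop :=
  ∃ a : ℕ → A, Function.Periodic a (Nat.card A) ∧ Function.Surjective a ∧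
    Function.Surjective fun i => a i + a (i + 1)

theorem Harmonic.of_addEquiv {A B : Type*} [AddCommGroup A] [AddCommGroup B] (f : A ≃+ B) :
    Harmonic A → Harmonic B := by
  rintro ⟨a, periodic, surj, surj_add⟩
  refine ⟨f ∘ a, ?_, f.surjective.comp surj, ?_⟩
  · rw [← Nat.card_congr f.toEquiv]
    exact periodic.comp f
  · convert f.surjective.comp surj_add using 1
    funext i
    exact (map_add f _ _).symm

theorem surjective_comp_finVal_of_periodic {α : Type*} {a : ℕ → α} {n : ℕ} [NeZero n]
    (periodic : Function.Periodic a n) (surj : Function.Surjective a) :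
    Function.Surjective fun i : Fin n => a i := by
  intro y
  obtain ⟨i, rfl⟩ := surj y
  exact ⟨Fin.ofNat n i, periodic.map_mod_nat i⟩

theorem mem_edgeSet_cycleGraph {n : ℕ} {e : Sym2 (Fin (n + 2))} :
    e ∈ (SimpleGraph.cycleGraph (n + 2)).edgeSet ↔ ∃ i, e = s(i, i + 1) := by
  induction e with
  | _ x y =>
    simp only [SimpleGraph.mem_edgeSet, SimpleGraph.cycleGraph_adj, sub_eq_iff_eq_add', Sym2.eq_iff]
    constructor
    · rintro (rfl | rfl)
      · exact ⟨y, Or.inr ⟨rfl, rfl⟩⟩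
      · exact ⟨x, Or.inl ⟨rfl, rfl⟩⟩
    · rintro ⟨i, ⟨rfl, rfl⟩ | ⟨rfl, rfl⟩⟩
      · exact Or.inr rfl
      · exact Or.inl rfl

theorem edgeLabel_mk {V Γ : Type*} [AddCommGroup Γ] (f : V → Γ) (x y : V) :
    edgeLabel f s(x, y) = f x + f y := rfl

theorem isHarmoniousLabeling_cycleGraph {A : Type*} [AddCommGroup A] {n : ℕ}
    {f : Fin (n + 2) → A} (bij : Function.Bijective f)
    (bij_add : Function.Bijective fun i => f i + f (i + 1)) :
    IsHarmoniousLabeling (SimpleGraph.cycleGraph (n + 2)) f := by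
  refine ⟨bij.1, Set.mapsTo_univ _ _, fun e he e' he' hee => ?_, fun y _ => ?_⟩
  · obtain ⟨i, rfl⟩ := mem_edgeSet_cycleGraph.1 he
    obtain ⟨j, rfl⟩ := mem_edgeSet_cycleGraph.1 he'
    exact congrArg (fun i => s(i, i + 1)) (bij_add.1 hee)
  · obtain ⟨i, hi⟩ := bij_add.2 y
    exact ⟨s(i, i + 1), mem_edgeSet_cycleGraph.2 ⟨i, rfl⟩, hi⟩

theorem Harmonic.exists_labeling {A : Type*} [AddCommGroup A] [Finite A] {n : ℕ} (hn : 2 ≤ n)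
    (hA : Nat.card A = n) (h : Harmonic A) :
    ∃ f : Fin n → A, IsHarmoniousLabeling (SimpleGraph.cycleGraph n) f := by
  obtain ⟨a, periodic, surj, surj_add⟩ := h
  rw [hA] at periodic
  obtain ⟨m, rfl⟩ := Nat.exists_eq_add_of_le' hn
  have card_eq : Nat.card (Fin (m + 2)) = Nat.card A := by rw [hA, Nat.card_fin]
  have apply_add_one (i : Fin (m + 2)) : a (i + 1 : Fin (m + 2)) = a (i + 1 : ℕ) := by
    rw [← periodic.map_mod_nat (i + 1 : ℕ), Fin.val_add, Fin.val_one]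
  refine ⟨fun i => a i, isHarmoniousLabeling_cycleGraph ?_ ?_⟩ <;>
    refine (Nat.bijective_iff_surjective_and_card _).2 ⟨?_, card_eq⟩
  · exact surjective_comp_finVal_of_periodic periodic surj
  · simp only [apply_add_one]
    exact surjective_comp_finVal_of_periodic (periodic.add (periodic.add_const 1)) surj_add

theorem exists_coset_representatives {Γ : Type*} [AddCommGroup Γ] {k : ℕ} (H : AddSubgroup Γ)
    (index_eq : H.index = k + 1) :
    ∃ g : Fin k → Γ,
      Set.BijOn (fun j => (QuotientAddGroup.mk (g j) : Γ ⧸ H)) Set.univ {0}ᶜ := by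
  have : Finite (Γ ⧸ H) := Nat.finite_of_card_ne_zero (index_eq.trans_ne k.succ_ne_zero)
  have card_eq : Nat.card ({0}ᶜ : Set (Γ ⧸ H)) = k := by
    rw [Nat.card_coe_set_eq, Set.ncard_compl, Set.ncard_singleton]
    exact Nat.sub_eq_of_eq_add index_eq
  let f : Fin k ≃ ({0}ᶜ : Set (Γ ⧸ H)) := (finCongr card_eq.symm).trans (Finite.equivFin _).symm
  refine ⟨fun j => (f j : Γ ⧸ H).out, ?_⟩
  simp only [QuotientAddGroup.out_eq']
  exact ⟨fun j _ => (f j).2, (Subtype.val_injective.comp f.injective).injOn,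
    fun y hy => ⟨f.symm ⟨y, hy⟩, trivial, by simp only [Equiv.apply_symm_apply]⟩⟩

section Superwheel

variable {k n : ℕ}

theorem mem_edgeSet_superwheel {e : Sym2 (Fin n ⊕ Fin k)} :
    e ∈ (superwheel k n).edgeSet ↔
      (∃ d ∈ (SimpleGraph.cycleGraph n).edgeSet, d.map Sum.inl = e) ∨
        ∃ i j, s(Sum.inl i, Sum.inr j) = e := by
  constructor
  · induction e with
    | _ x y =>
      rw [SimpleGraph.mem_edgeSet, superwheel, SimpleGraph.sup_adj]
      rcases x with x | x <;> rcases y with y | y <;> intro he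
      · exact Or.inl ⟨s(x, y), by simpa using he, rfl⟩
      · exact Or.inr ⟨x, y, rfl⟩
      · exact Or.inr ⟨y, x, Sym2.eq_swap⟩
      · simp at he
  · rintro (⟨⟨x, y⟩, hd, rfl⟩ | ⟨i, j, rfl⟩)
    · exact Or.inl (by simpa using hd)
    · simp [superwheel]

variable {Γ : Type*} [AddCommGroup Γ] {H : AddSubgroup Γ} {h : Fin n → H} {g : Fin k → Γ}

theorem edgeLabel_sumElim_map_inl (d : Sym2 (Fin n)) :
    edgeLabel (Sum.elim (fun i => (h i : Γ)) g) (d.map Sum.inl) = (edgeLabel h d : H) := by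
  induction d with
  | _ x y => rfl

theorem edgeLabel_sumElim_inl_inr (i : Fin n) (j : Fin k) :
    edgeLabel (Sum.elim (fun i => (h i : Γ)) g) s(Sum.inl i, Sum.inr j) = h i + g j := rfl

theorem mk_subgroup_add (x : H) (y : Γ) :
    (QuotientAddGroup.mk (x + y) : Γ ⧸ H) = QuotientAddGroup.mk y := by
  rw [add_comm, QuotientAddGroup.mk_add_of_mem y x.2]

theorem injOn_edgeLabel_superwheel (h_inj : Function.Injective h)
    (h_label : Set.InjOn (edgeLabel h) (SimpleGraph.cycleGraph n).edgeSet)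
    (hg : Set.BijOn (fun j => (QuotientAddGroup.mk (g j) : Γ ⧸ H)) Set.univ {0}ᶜ) :
    Set.InjOn (edgeLabel (Sum.elim (fun i => (h i : Γ)) g)) (superwheel k n).edgeSet := by
  have hub_notMem (i : Fin n) (j : Fin k) : (h i + g j : Γ) ∉ H := fun hmem =>
    hg.mapsTo (Set.mem_univ j) ((mk_subgroup_add (h i) (g j)).symm.trans
      ((QuotientAddGroup.eq_zero_iff _).2 hmem))
  intro e he e' he' hee
  rcases mem_edgeSet_superwheel.1 he with ⟨d, hd, rfl⟩ | ⟨i, j, rfl⟩ <;>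
    rcases mem_edgeSet_superwheel.1 he' with ⟨d', hd', rfl⟩ | ⟨i', j', rfl⟩ <;>
    simp only [edgeLabel_sumElim_map_inl, edgeLabel_sumElim_inl_inr] at hee
  · rw [h_label hd hd' (Subtype.ext hee)]
  · exact absurd (hee ▸ SetLike.coe_mem _) (hub_notMem i' j')
  · exact absurd (hee.symm ▸ SetLike.coe_mem _) (hub_notMem i j)
  · obtain rfl : j = j' := hg.injOn (Set.mem_univ j) (Set.mem_univ j') <| by
      simpa only [mk_subgroup_add] using congrArg (QuotientAddGroup.mk : Γ → Γ ⧸ H) hee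
    rw [h_inj (Subtype.ext (add_right_cancel hee))]

theorem surjOn_edgeLabel_superwheel (h_surj : Function.Surjective h)
    (h_label : Set.SurjOn (edgeLabel h) (SimpleGraph.cycleGraph n).edgeSet Set.univ)
    (hg : Set.BijOn (fun j => (QuotientAddGroup.mk (g j) : Γ ⧸ H)) Set.univ {0}ᶜ) :
    Set.SurjOn (edgeLabel (Sum.elim (fun i => (h i : Γ)) g)) (superwheel k n).edgeSet
      Set.univ := by
  intro y _
  by_cases hy : y ∈ H
  · obtain ⟨d, hd, hdy⟩ := h_label (Set.mem_univ (⟨y, hy⟩ : H))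
    exact ⟨d.map Sum.inl, mem_edgeSet_superwheel.2 (Or.inl ⟨d, hd, rfl⟩),
      by rw [edgeLabel_sumElim_map_inl, hdy]⟩
  · obtain ⟨j, -, hj⟩ := hg.surjOn (mt (QuotientAddGroup.eq_zero_iff y).1 hy)
    obtain ⟨i, hi⟩ := h_surj ⟨-g j + y, QuotientAddGroup.eq.1 hj⟩
    refine ⟨s(Sum.inl i, Sum.inr j), mem_edgeSet_superwheel.2 (Or.inr ⟨i, j, rfl⟩), ?_⟩
    rw [edgeLabel_sumElim_inl_inr, hi, add_comm]
    exact add_neg_cancel_left _ _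

theorem isHarmoniousLabeling_superwheel [Finite H] (hH : Nat.card H = n)
    (hh : IsHarmoniousLabeling (SimpleGraph.cycleGraph n) h)
    (hg : Set.BijOn (fun j => (QuotientAddGroup.mk (g j) : Γ ⧸ H)) Set.univ {0}ᶜ) :
    IsHarmoniousLabeling (superwheel k n) (Sum.elim (fun i => (h i : Γ)) g) := by
  have h_bij : Function.Bijective h :=
    (Nat.bijective_iff_injective_and_card h).2 ⟨hh.1, by rw [hH, Nat.card_fin]⟩
  have g_notMem (j : Fin k) : g j ∉ H := fun hmem =>
    hg.mapsTo (Set.mem_univ j) ((QuotientAddGroup.eq_zero_iff _).2 hmem)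
  have g_inj : Function.Injective g := fun i j hij =>
    hg.injOn (Set.mem_univ i) (Set.mem_univ j) (congrArg QuotientAddGroup.mk hij)
  exact ⟨(Subtype.val_injective.comp h_bij.1).sumElim g_inj fun i j hij =>
      g_notMem j (hij ▸ (h i).2),
    Set.mapsTo_univ _ _, injOn_edgeLabel_superwheel h_bij.1 hh.2.injOn hg,
    surjOn_edgeLabel_superwheel h_bij.2 hh.2.surjOn hg⟩

end Superwheel

/-- Within each block of `m` consecutive indices, `zigzag m` alternates between the number of the
block and its successor. It tells an extension of a group of odd order `m` how to move in the kernel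
while cycling through the quotient. -/
def zigzag (m i : ℕ) : ℕ := i / m + i % m % 2

section zigzag

variable {m : ℕ}

theorem zigzag_add_mul (hm : 0 < m) (i r : ℕ) : zigzag m (i + m * r) = zigzag m i + r := by
  rw [zigzag, Nat.add_mul_div_left i r hm, Nat.add_mul_mod_self_left, zigzag, add_right_comm]

theorem sym2_zigzag_succ (hm : Odd m) (i : ℕ) :
    s(zigzag m i, zigzag m (i + 1)) = s(i / m, i / m + 1) := by
  have hm_pos := hm.pos
  have div_add_mod := Nat.div_add_mod i m
  rcases Nat.lt_or_ge (i % m + 1) m with inside | atEnd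
  · have div_succ : (i + 1) / m = i / m := by
      rw [← div_add_mod, add_assoc, Nat.mul_add_div hm_pos, Nat.div_eq_of_lt inside,
        Nat.mul_add_div hm_pos, Nat.mod_div_self]
    have mod_succ : (i + 1) % m = i % m + 1 := by
      rw [← Nat.mod_add_mod, Nat.mod_eq_of_lt inside]
    simp only [zigzag, div_succ, mod_succ]
    rcases Nat.mod_two_eq_zero_or_one (i % m) with even | odd
    · rw [even, Nat.succ_mod_two_eq_one_iff.2 even, add_zero]
    · rw [odd, Nat.succ_mod_two_eq_zero_iff.2 odd, add_zero, Sym2.eq_swap]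
  · have mod_eq : i % m + 1 = m := le_antisymm (Nat.mod_lt i hm_pos) atEnd
    have even : i % m % 2 = 0 := by
      obtain ⟨t, ht⟩ := hm
      omega
    have succ_eq : i + 1 = m * (i / m + 1) := by rw [mul_add, mul_one]; omega
    simp only [zigzag, even, succ_eq, Nat.mul_div_cancel_left _ hm_pos, Nat.mul_mod_right,
      Nat.zero_mod, add_zero]

end zigzag

theorem surjective_comp_const_add_of_periodic {α : Type*} {a : ℕ → α} {n : ℕ} (hn : 0 < n)
    (periodic : Function.Periodic a n) (surj : Function.Surjective a) (c : ℕ) :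
    Function.Surjective fun i => a (c + i) := by
  intro y
  obtain ⟨j, rfl⟩ := surj y
  obtain ⟨n, rfl⟩ := Nat.exists_eq_add_one.2 hn
  refine ⟨j + c * n, ?_⟩
  convert periodic.nat_mul c j using 2
  push_cast
  ring

namespace Harmonic

variable {A B : Type*} [AddCommGroup A] [AddCommGroup B]

theorem of_ker_of_odd [Finite A] (φ : A →+ B) (hφ : Function.Surjective φ)
    (hK : Harmonic φ.ker) (hB : Harmonic B) (odd : Odd (Nat.card B)) : Harmonic A := by
  obtain ⟨k, k_periodic, k_surj, k_add_surj⟩ := hK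
  obtain ⟨q, q_periodic, q_surj, q_add_surj⟩ := hB
  obtain ⟨e, he⟩ := hφ.hasRightInverse
  set m := Nat.card B
  set r := Nat.card φ.ker
  have r_pos : 0 < r := Nat.card_pos
  have card_eq : Nat.card A = m * r := by
    rw [AddSubgroup.card_eq_card_quotient_mul_card_addSubgroup φ.ker,
      Nat.card_congr (QuotientAddGroup.quotientKerEquivOfSurjective φ hφ).toEquiv]
  have q_add_mul (i s : ℕ) : q (i + m * s) = q i := by
    rw [mul_comm]
    exact q_periodic.nat_mul s i
  have k_zigzag (i : ℕ) :
      k (zigzag m i) + k (zigzag m (i + 1)) = k (i / m) + k (i / m + 1) :=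
    congrArg (edgeLabel k) (sym2_zigzag_succ odd i)
  have exists_ker (y y' : A) (h : φ y' = φ y) : ∃ κ : φ.ker, y = y' + κ :=
    ⟨⟨y - y', by rw [AddMonoidHom.mem_ker, map_sub, h, sub_self]⟩,
      (add_sub_cancel y' y).symm⟩
  refine ⟨fun i => e (q i) + k (zigzag m i), fun i => ?_, fun y => ?_, fun y => ?_⟩
  · simp only [card_eq, q_add_mul, zigzag_add_mul odd.pos]
    rw [k_periodic]
  · obtain ⟨i, hi⟩ := q_surj (φ y)
    obtain ⟨κ, rfl⟩ := exists_ker y (e (q i)) (by rw [he, hi])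
    obtain ⟨s, rfl⟩ :=
      surjective_comp_const_add_of_periodic r_pos k_periodic k_surj (zigzag m i) κ
    exact ⟨i + m * s, by simp only [q_add_mul, zigzag_add_mul odd.pos]⟩
  · obtain ⟨i, hi⟩ := q_add_surj (φ y)
    obtain ⟨κ, rfl⟩ := exists_ker y (e (q i) + e (q (i + 1))) (by rw [map_add, he, he, ← hi])
    obtain ⟨s, rfl⟩ := surjective_comp_const_add_of_periodic r_pos
      (k_periodic.add (k_periodic.add_const 1)) k_add_surj (i / m) κ
    refine ⟨i + m * s, ?_⟩
    have sum_eq := k_zigzag (i + m * s)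
    rw [Nat.add_mul_div_left i s odd.pos] at sum_eq
    simp only [Pi.add_apply, ← sum_eq, AddSubgroup.coe_add, q_add_mul, add_right_comm i _ 1]
    exact add_add_add_comm _ _ _ _

theorem of_isAddCyclic_of_odd_card [Finite A] [IsAddCyclic A] (odd : Odd (Nat.card A)) :
    Harmonic A := by
  obtain ⟨g, hg⟩ := IsAddCyclic.exists_generator (α := A)
  have nsmul_surj : Function.Surjective fun i : ℕ => i • g := fun y =>
    mem_multiples_iff_mem_zmultiples.2 (hg y)
  refine ⟨fun i => i • g, fun i => ?_, nsmul_surj, fun y => ?_⟩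
  · simp only [add_smul, card_nsmul_eq_zero', add_zero]
  · obtain ⟨z, hz⟩ := (nsmulCoprime (Nat.coprime_two_right.2 odd)).surjective (y - g)
    obtain ⟨i, rfl⟩ := nsmul_surj z
    refine ⟨i, ?_⟩
    rw [nsmulCoprime_apply, two_nsmul, eq_sub_iff_add_eq] at hz
    simpa only [add_smul, one_smul, ← add_assoc] using hz

theorem of_odd_card (A : Type*) [AddCommGroup A] [Finite A] (odd : Odd (Nat.card A)) :
    Harmonic A := by
  induction hn : Nat.card A using Nat.strong_induction_on generalizing A with
  | _ n ih =>
    subst hn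
    rcases subsingleton_or_nontrivial A with _ | _
    · exact of_isAddCyclic_of_odd_card odd
    · obtain ⟨x, hx⟩ := exists_ne (0 : A)
      let C := AddSubgroup.zmultiples x
      have card_eq : Nat.card A = Nat.card (A ⧸ C) * Nat.card C :=
        AddSubgroup.card_eq_card_quotient_mul_card_addSubgroup C
      obtain ⟨odd_quotient, odd_C⟩ := Nat.odd_mul.1 (card_eq ▸ odd)
      have card_lt : Nat.card (A ⧸ C) < Nat.card A := by
        rw [card_eq]
        refine lt_mul_of_one_lt_right Nat.card_pos ?_
        rwa [AddSubgroup.one_lt_card_iff_ne_bot, AddSubgroup.zmultiples_ne_bot]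
      refine of_ker_of_odd (QuotientAddGroup.mk' C) (QuotientAddGroup.mk'_surjective C) ?_
        (ih _ card_lt _ odd_quotient rfl) odd_quotient
      rw [QuotientAddGroup.ker_mk']
      exact of_isAddCyclic_of_odd_card odd_C

theorem of_ker_of_odd_card [Finite A] (φ : A →+ B) (hφ : Function.Surjective φ)
    (hK : Harmonic φ.ker) (odd : Odd (Nat.card B)) : Harmonic A :=
  have : Finite B := Finite.of_surjective φ hφ
  of_ker_of_odd φ hφ hK (of_odd_card B odd) odd

end Harmonic

/-- The nonempty list `l` starts with `x` and ends with `y`. -/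
structure HasEnds {α : Type*} (l : List α) (x y : α) : Prop where
  head : l.head? = some x
  last : l.getLast? = some y

namespace HasEnds

variable {α β : Type*} {l l₁ l₂ : List α} {x y z w : α}

theorem ne_nil (h : HasEnds l x y) : l ≠ [] := by
  rintro rfl
  cases h.head

theorem singleton (x : α) : HasEnds [x] x x := ⟨rfl, rfl⟩

theorem left_mem (h : HasEnds l x y) : x ∈ l := List.mem_of_head? h.head

theorem right_mem (h : HasEnds l x y) : y ∈ l := List.mem_of_getLast? h.last

theorem eq_and_eq (h : HasEnds l x y) (h' : HasEnds l z w) : x = z ∧ y = w :=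
  ⟨Option.some.inj (h.head.symm.trans h'.head), Option.some.inj (h.last.symm.trans h'.last)⟩

theorem append (h₁ : HasEnds l₁ x y) (h₂ : HasEnds l₂ z w) : HasEnds (l₁ ++ l₂) x w :=
  ⟨by rw [List.head?_append, h₁.head, Option.some_or],
    by rw [List.getLast?_append, h₂.last, Option.some_or]⟩

theorem map (f : α → β) (h : HasEnds l x y) : HasEnds (l.map f) (f x) (f y) :=
  ⟨by rw [List.head?_map, h.head, Option.map_some],
    by rw [List.getLast?_map, h.last, Option.map_some]⟩

theorem reverse (h : HasEnds l x y) : HasEnds l.reverse y x :=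
  ⟨by rw [List.head?_reverse, h.last], by rw [List.getLast?_reverse, h.head]⟩

end HasEnds

/-- `u` and `v` occupy consecutive positions of `l`, in either order: a list is read as a path. -/
def Linked {α : Type*} (l : List α) (u v : α) : Prop :=
  [u, v] <:+: l ∨ [v, u] <:+: l

/-- `u` and `v` occupy cyclically consecutive positions of `l`, in either order: the path `l` is
closed up to a cycle. -/
def CyclicallyLinked {α : Type*} (l : List α) (u v : α) : Prop :=
  Linked l u v ∨ HasEnds l u v ∨ HasEnds l v u

section Adjacency

variable {α β : Type*} {l l₁ l₂ : List α} {u v x y z w : α}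

theorem pair_infix_append_iff (h₁ : HasEnds l₁ x y) (h₂ : HasEnds l₂ z w) :
    [u, v] <:+: l₁ ++ l₂ ↔ [u, v] <:+: l₁ ∨ [u, v] <:+: l₂ ∨ u = y ∧ v = z := by
  rw [List.infix_append_iff_ne_nil]
  refine or_congr_right (or_congr_right ⟨?_, ?_⟩)
  · rintro ⟨p, q, hp, hq, hpq, hps, hqt⟩
    obtain ⟨rfl, rfl⟩ : p = [u] ∧ q = [v] := by
      rcases p with _ | ⟨p₀, _ | ⟨p₁, p⟩⟩ <;> rcases q with _ | ⟨q₀, q⟩ <;> simp_all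
    rw [List.singleton_suffix_iff_getLast?_eq_some, h₁.last] at hps
    rw [List.singleton_prefix_iff_head?_eq_some, h₂.head] at hqt
    exact ⟨(Option.some.inj hps).symm, (Option.some.inj hqt).symm⟩
  · rintro ⟨rfl, rfl⟩
    exact ⟨[u], [v], List.cons_ne_nil _ _, List.cons_ne_nil _ _, rfl,
      List.singleton_suffix_iff_getLast?_eq_some.2 h₁.last,
      List.singleton_prefix_iff_head?_eq_some.2 h₂.head⟩

namespace Linked

theorem symm (h : Linked l u v) : Linked l v u := Or.symm h

theorem of_infix (h : Linked l₁ u v) (hl : l₁ <:+: l₂) : Linked l₂ u v :=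
  Or.imp (·.trans hl) (·.trans hl) h

theorem left_mem (h : Linked l u v) : u ∈ l :=
  h.elim (fun h => h.subset List.mem_cons_self) (fun h => h.subset (by simp))

theorem right_mem (h : Linked l u v) : v ∈ l := h.symm.left_mem

theorem map (f : α → β) (h : Linked l u v) : Linked (l.map f) (f u) (f v) :=
  Or.imp (fun h => h.map f) (fun h => h.map f) h

theorem reverse (h : Linked l u v) : Linked l.reverse u v :=
  h.symm.imp List.reverse_infix.2 List.reverse_infix.2

end Linked

theorem linked_append_iff (h₁ : HasEnds l₁ x y) (h₂ : HasEnds l₂ z w) :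
    Linked (l₁ ++ l₂) u v ↔ Linked l₁ u v ∨ Linked l₂ u v ∨ s(u, v) = s(y, z) := by
  simp only [Linked, pair_infix_append_iff h₁ h₂, Sym2.eq_iff]
  tauto

theorem cyclicallyLinked_append_iff (h₁ : HasEnds l₁ x y) (h₂ : HasEnds l₂ z w) :
    CyclicallyLinked (l₁ ++ l₂) u v ↔
      Linked l₁ u v ∨ Linked l₂ u v ∨ s(u, v) = s(y, z) ∨ s(u, v) = s(w, x) := by
  have ends_iff (u v : α) : HasEnds (l₁ ++ l₂) u v ↔ u = x ∧ v = w :=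
    ⟨fun h => h.eq_and_eq (h₁.append h₂), by rintro ⟨rfl, rfl⟩; exact h₁.append h₂⟩
  simp only [CyclicallyLinked, linked_append_iff h₁ h₂, ends_iff, Sym2.eq_iff]
  tauto

theorem CyclicallyLinked.map (f : α → β) (h : CyclicallyLinked l u v) :
    CyclicallyLinked (l.map f) (f u) (f v) :=
  h.imp (Linked.map f) (Or.imp (HasEnds.map f) (HasEnds.map f))

theorem HasEnds.cons (x : α) (l : List α) : ∃ y, HasEnds (x :: l) x y :=
  ⟨_, rfl, List.getLast?_eq_some_getLast (List.cons_ne_nil x l)⟩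

theorem HasEnds.concat (l : List α) (y : α) : ∃ x, HasEnds (l ++ [y]) x y := by
  obtain ⟨x, h⟩ := HasEnds.cons y l.reverse
  exact ⟨x, by simpa only [List.reverse_cons, List.reverse_reverse] using h.reverse⟩

theorem exists_cut_of_pair_infix (h : [u, v] <:+: l) :
    ∃ l' : List α, l'.Perm l ∧ HasEnds l' v u ∧
      ∀ p q, CyclicallyLinked l p q → s(p, q) = s(u, v) ∨ Linked l' p q := by
  obtain ⟨s, t, rfl⟩ := h
  rw [show s ++ [u, v] ++ t = s ++ [u] ++ v :: t by simp only [List.append_assoc, List.cons_append,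
    List.nil_append]]
  obtain ⟨x, hs⟩ := HasEnds.concat s u
  obtain ⟨y, ht⟩ := HasEnds.cons v t
  refine ⟨v :: t ++ (s ++ [u]), List.perm_append_comm, ht.append hs, fun p q hpq => ?_⟩
  rw [cyclicallyLinked_append_iff hs ht] at hpq
  rw [linked_append_iff ht hs]
  tauto

theorem Linked.exists_cut (h : Linked l u v) :
    ∃ l' : List α, l'.Perm l ∧ HasEnds l' u v ∧
      ∀ p q, CyclicallyLinked l p q → s(p, q) = s(u, v) ∨ Linked l' p q := by
  rcases h with h | h <;> obtain ⟨l', perm, ends, linked⟩ := exists_cut_of_pair_infix h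
  · exact ⟨l'.reverse, l'.reverse_perm.trans perm, ends.reverse,
      fun p q hpq => (linked p q hpq).imp_right Linked.reverse⟩
  · exact ⟨l', perm, ends, fun p q hpq => (linked p q hpq).imp_left (·.trans Sym2.eq_swap)⟩

theorem pair_infix_of_mem_zip {x : α} (h : (u, v) ∈ (x :: l).zip (l ++ [w])) :
    [u, v] <:+: x :: l ++ [w] := by
  induction l generalizing x with
  | nil =>
    obtain ⟨rfl, rfl⟩ : u = x ∧ v = w := by simpa using h
    exact List.infix_rfl
  | cons z t ih =>
    rw [List.cons_append, List.zip_cons_cons, List.mem_cons, Prod.mk.injEq] at h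
    rcases h with ⟨rfl, rfl⟩ | h
    · exact ⟨[], t ++ [w], rfl⟩
    · exact (ih h).trans (List.suffix_cons _ _).isInfix

theorem cyclicallyLinked_of_mem_zip {x : α} (h : (u, v) ∈ (x :: l).zip (l ++ [x])) :
    CyclicallyLinked (x :: l) u v := by
  obtain ⟨y, hl⟩ := HasEnds.cons x l
  rcases (pair_infix_append_iff hl (HasEnds.singleton x)).1 (pair_infix_of_mem_zip h) with
    h | h | ⟨rfl, rfl⟩
  · exact Or.inl (Or.inl h)
  · exact absurd h.length_le (by simp)
  · exact Or.inr (Or.inr hl)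

theorem exists_getElem_of_pair_infix (h : [u, v] <:+: l) :
    ∃ (i : ℕ) (hi : i + 1 < l.length), l[i] = u ∧ l[i + 1] = v := by
  obtain ⟨s, t, rfl⟩ := h
  exact ⟨s.length, by simp, by simp, by simp⟩

theorem CyclicallyLinked.exists_getElem (h : CyclicallyLinked l u v) :
    ∃ (i : ℕ) (hi : i < l.length),
      s(l[i], l[(i + 1) % l.length]'(Nat.mod_lt _ (by omega))) = s(u, v) := by
  have of_pair (u v : α) (h : [u, v] <:+: l) : ∃ (i : ℕ) (hi : i < l.length),
      s(l[i], l[(i + 1) % l.length]'(Nat.mod_lt _ (by omega))) = s(u, v) := by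
    obtain ⟨i, hi, rfl, rfl⟩ := exists_getElem_of_pair_infix h
    exact ⟨i, by omega, by simp only [Nat.mod_eq_of_lt hi]⟩
  have of_ends (u v : α) (h : HasEnds l u v) : ∃ (i : ℕ) (hi : i < l.length),
      s(l[i], l[(i + 1) % l.length]'(Nat.mod_lt _ (by omega))) = s(v, u) := by
    have length_pos := List.length_pos_iff.2 h.ne_nil
    refine ⟨l.length - 1, by omega, ?_⟩
    obtain ⟨head, last⟩ := h
    rw [List.head?_eq_some_head (List.length_pos_iff.1 length_pos), Option.some_inj,
      List.head_eq_getElem] at head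
    rw [List.getLast?_eq_some_getLast (List.length_pos_iff.1 length_pos), Option.some_inj,
      List.getLast_eq_getElem] at last
    simp only [Nat.sub_add_cancel length_pos, Nat.mod_self, head, last]
  rcases h with (h | h) | h | h
  · exact of_pair u v h
  · exact Sym2.eq_swap (a := v) ▸ of_pair v u h
  · exact Sym2.eq_swap (a := v) ▸ of_ends u v h
  · exact of_ends v u h

end Adjacency

/-- A list that enumerates a group in such a way that the sums of cyclically consecutive elements
run through the group as well. -/
structure IsHarmonicCycle {A : Type*} [AddCommGroup A] (l : List A) : Prop where
  length_eq : l.length = Nat.card A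
  mem : ∀ x, x ∈ l
  sum : ∀ y, ∃ u v, CyclicallyLinked l u v ∧ u + v = y

namespace IsHarmonicCycle

variable {A B : Type*} [AddCommGroup A] [AddCommGroup B] {l l₁ l₂ : List A}

theorem harmonic [Finite A] (h : IsHarmonicCycle l) : Harmonic A := by
  have length_pos : 0 < l.length := h.length_eq ▸ Nat.card_pos
  refine ⟨fun i => l[i % l.length]'(Nat.mod_lt i length_pos), fun i => ?_, fun x => ?_,
    fun y => ?_⟩
  · simp only [← h.length_eq, Nat.add_mod_right]
  · obtain ⟨i, hi, hx⟩ := List.getElem_of_mem (h.mem x)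
    exact ⟨i, by simpa only [Nat.mod_eq_of_lt hi] using hx⟩
  · obtain ⟨u, v, huv, rfl⟩ := h.sum y
    obtain ⟨i, hi, hi'⟩ := huv.exists_getElem
    refine ⟨i, ?_⟩
    simpa only [Nat.mod_eq_of_lt hi, edgeLabel_mk, id] using congrArg (edgeLabel id) hi'

theorem nodup [Finite A] (h : IsHarmonicCycle l) : l.Nodup := by
  classical
  have := Fintype.ofFinite A
  have toFinset_eq : l.toFinset = Finset.univ :=
    Finset.eq_univ_iff_forall.2 fun x => List.mem_toFinset.2 (h.mem x)
  rw [← Multiset.coe_nodup, ← Multiset.toFinset_card_eq_card_iff_nodup, List.toFinset_coe,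
    toFinset_eq, Multiset.coe_card, h.length_eq, Finset.card_univ, Nat.card_eq_fintype_card]

theorem append_comm {x y z w : A} (h₁ : HasEnds l₁ x y) (h₂ : HasEnds l₂ z w)
    (h : IsHarmonicCycle (l₁ ++ l₂)) : IsHarmonicCycle (l₂ ++ l₁) where
  length_eq := List.perm_append_comm.length_eq.trans h.length_eq
  mem x := List.perm_append_comm.subset (h.mem x)
  sum y := by
    obtain ⟨u, v, huv, hy⟩ := h.sum y
    refine ⟨u, v, ?_, hy⟩
    rw [cyclicallyLinked_append_iff h₁ h₂] at huv
    rw [cyclicallyLinked_append_iff h₂ h₁]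
    tauto

theorem map (f : A ≃+ B) (h : IsHarmonicCycle l) : IsHarmonicCycle (l.map f) where
  length_eq := by rw [List.length_map, h.length_eq, Nat.card_congr f.toEquiv]
  mem x := List.mem_map.2 ⟨f.symm x, h.mem _, f.apply_symm_apply x⟩
  sum y := by
    obtain ⟨u, v, huv, hy⟩ := h.sum (f.symm y)
    exact ⟨f u, f v, huv.map f, by rw [← map_add, hy, f.apply_symm_apply]⟩

theorem of_mem_zip {x : A} (length_eq : (x :: l).length = Nat.card A) (mem : ∀ y, y ∈ x :: l)
    (sum : ∀ y, ∃ p ∈ (x :: l).zip (l ++ [x]), p.1 + p.2 = y) : IsHarmonicCycle (x :: l) where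
  length_eq := length_eq
  mem := mem
  sum y := by
    obtain ⟨⟨u, v⟩, huv, hy⟩ := sum y
    exact ⟨u, v, cyclicallyLinked_of_mem_zip huv, hy⟩

end IsHarmonicCycle

section FlatMapRange

variable {α : Type*} {f : ℕ → List α} {x y : ℕ → α} {i n r : ℕ}

theorem hasEnds_flatMap_range' (hf : ∀ r, HasEnds (f r) (x r) (y r)) (i n : ℕ) :
    HasEnds ((List.range' i (n + 1)).flatMap f) (x i) (y (i + n)) := by
  induction n with
  | zero => simpa using hf i
  | succ n ih =>
    rw [List.range'_1_concat, List.flatMap_append, List.flatMap_singleton]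
    exact ih.append (hf _)

theorem infix_flatMap_range' (hr : i ≤ r) (hrn : r < i + n) :
    f r <:+: (List.range' i n).flatMap f := by
  obtain ⟨s, t, hst⟩ := List.append_of_mem (List.mem_range'_1.2 ⟨hr, hrn⟩)
  rw [hst, List.flatMap_append, List.flatMap_cons]
  exact (List.prefix_append _ _).isInfix.trans (List.suffix_append _ _).isInfix

theorem pair_infix_range' (hr : i ≤ r) (hrn : r + 1 < i + n) :
    [r, r + 1] <:+: List.range' i n := by
  obtain ⟨s, rfl⟩ := Nat.exists_eq_add_of_le hr
  obtain ⟨t, rfl⟩ : ∃ t, n = s + (2 + t) := ⟨n - (s + 2), by omega⟩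
  rw [← List.range'_append_1, ← List.range'_append_1, ← List.append_assoc]
  exact ⟨_, _, rfl⟩

theorem linked_flatMap_range' (hf : ∀ r, HasEnds (f r) (x r) (y r)) (hr : i ≤ r)
    (hrn : r + 1 < i + n) : Linked ((List.range' i n).flatMap f) (y r) (x (r + 1)) := by
  refine Linked.of_infix ?_ ((pair_infix_range' hr hrn).flatMap f)
  rw [List.flatMap_cons, List.flatMap_singleton, linked_append_iff (hf r) (hf (r + 1))]
  exact Or.inr (Or.inr rfl)

end FlatMapRange

section Coloring

variable {α κ : Type*} {l : List α} {x y u v : α} {s t p q : κ}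

theorem not_linked_singleton : ¬Linked [x] u v := fun h =>
  h.elim (fun h => absurd h.length_le (by simp)) (fun h => absurd h.length_le (by simp))

theorem exists_path_coloring (hκ : 3 ≤ ENat.card κ) (nodup : l.Nodup) (h : HasEnds l x y)
    (ends_iff : x = y ↔ s = t) :
    ∃ g : α → κ, g x = s ∧ g y = t ∧ ∀ u v, Linked l u v → g u ≠ g v := by
  classical
  induction l generalizing x s with
  | nil => exact absurd rfl h.ne_nil
  | cons w l ih =>
    obtain rfl : w = x := Option.some.inj h.head
    rcases l with _ | ⟨z, l⟩
    · obtain rfl : w = y := Option.some.inj h.last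
      exact ⟨fun _ => s, rfl, ends_iff.1 rfl, fun u v huv => absurd huv not_linked_singleton⟩
    · obtain ⟨w_notMem, nodup⟩ := List.nodup_cons.1 nodup
      have h' : HasEnds (z :: l) z y := ⟨rfl, h.last⟩
      have ne_w {u : α} (hu : u ∈ z :: l) : u ≠ w := ne_of_mem_of_not_mem hu w_notMem
      have hst : s ≠ t := mt ends_iff.2 (ne_w h'.right_mem).symm
      obtain ⟨r, hrs, hrt⟩ : ∃ r, r ≠ s ∧ (z = y ↔ r = t) := by
        by_cases hz : z = y
        · exact ⟨t, hst.symm, iff_of_true hz rfl⟩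
        · obtain ⟨r, hrs, hrt⟩ := ENat.exists_ne_ne_of_three_le hκ s t
          exact ⟨r, hrs, iff_of_false hz hrt⟩
      obtain ⟨g, rfl, rfl, hg⟩ := ih nodup h' hrt
      have update_eq {u : α} (hu : u ∈ z :: l) : Function.update g w s u = g u :=
        Function.update_of_ne (ne_w hu) _ _
      refine ⟨Function.update g w s, Function.update_self .., update_eq h'.right_mem,
        fun u v huv => ?_⟩
      rw [← List.singleton_append, linked_append_iff (HasEnds.singleton w) h', Sym2.eq_iff] at huv
      rcases huv with huv | huv | ⟨rfl, rfl⟩ | ⟨rfl, rfl⟩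
      · exact absurd huv not_linked_singleton
      · simpa only [update_eq huv.left_mem, update_eq huv.right_mem] using hg u v huv
      · simpa only [Function.update_self, update_eq h'.left_mem] using hrs.symm
      · simpa only [Function.update_self, update_eq h'.left_mem] using hrs

theorem exists_append_of_pair_infix (h : HasEnds l x y) (huv : [u, v] <:+: l) :
    ∃ l₁ l₂, l = l₁ ++ l₂ ∧ HasEnds l₁ x u ∧ HasEnds l₂ v y := by
  obtain ⟨s, t, rfl⟩ := huv
  obtain ⟨x', hs⟩ := HasEnds.concat s u
  obtain ⟨y', ht⟩ := HasEnds.cons v t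
  have append_eq : s ++ [u, v] ++ t = s ++ [u] ++ v :: t := by
    simp only [List.append_assoc, List.cons_append, List.nil_append]
  rw [append_eq] at h ⊢
  obtain ⟨rfl, rfl⟩ := h.eq_and_eq (hs.append ht)
  exact ⟨_, _, rfl, hs, ht⟩

theorem exists_eq_on_of_disjoint {l₁ l₂ : List α} (disjoint : l₁.Disjoint l₂) (g₁ g₂ : α → κ) :
    ∃ g : α → κ, (∀ u ∈ l₁, g u = g₁ u) ∧ ∀ u ∈ l₂, g u = g₂ u := by
  classical
  exact ⟨fun u => if u ∈ l₁ then g₁ u else g₂ u, fun u hu => if_pos hu,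
    fun u hu => if_neg fun hu' => disjoint hu' hu⟩

theorem exists_path_coloring_of_pair_infix (hκ : 3 ≤ ENat.card κ) (nodup : l.Nodup)
    (h : HasEnds l x y) (huv : [u, v] <:+: l) (left : x = u ↔ s = p) (right : v = y ↔ q = t)
    (hpq : p ≠ q) :
    ∃ g : α → κ, g x = s ∧ g y = t ∧ g u = p ∧ g v = q ∧ ∀ u v, Linked l u v → g u ≠ g v := by
  obtain ⟨l₁, l₂, rfl, h₁, h₂⟩ := exists_append_of_pair_infix h huv
  obtain ⟨nodup₁, nodup₂, disjoint⟩ := List.nodup_append'.1 nodup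
  obtain ⟨g₁, rfl, rfl, hg₁⟩ := exists_path_coloring hκ nodup₁ h₁ left
  obtain ⟨g₂, rfl, rfl, hg₂⟩ := exists_path_coloring hκ nodup₂ h₂ right
  obtain ⟨g, eq₁, eq₂⟩ := exists_eq_on_of_disjoint disjoint g₁ g₂
  refine ⟨g, eq₁ _ h₁.left_mem, eq₂ _ h₂.right_mem, eq₁ _ h₁.right_mem, eq₂ _ h₂.left_mem,
    fun w z hwz => ?_⟩
  rw [linked_append_iff h₁ h₂, Sym2.eq_iff] at hwz
  rcases hwz with hwz | hwz | ⟨rfl, rfl⟩ | ⟨rfl, rfl⟩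
  · rw [eq₁ w hwz.left_mem, eq₁ z hwz.right_mem]
    exact hg₁ w z hwz
  · rw [eq₂ w hwz.left_mem, eq₂ z hwz.right_mem]
    exact hg₂ w z hwz
  · rwa [eq₁ w h₁.right_mem, eq₂ z h₂.left_mem]
  · rw [eq₁ z h₁.right_mem, eq₂ w h₂.left_mem]
    exact hpq.symm

end Coloring

/-- A harmonic cycle made of a path `X` from `b'` to `c` and a path `Y` from `c'` to `b`, one of
which contains a link between `a` and `a'`. The sums are such that `c c'`, `b b'` and `a a'` can be
replaced by `a b'`, `a' c'` and `b c` without changing the set of sums; this is what it takes to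
lift the cycle to an extension by an elementary abelian `2`-group. -/
structure Switch (A : Type*) [AddCommGroup A] where
  (X Y : List A)
  (a a' b b' c c' : A)
  cycle : IsHarmonicCycle (X ++ Y)
  left : HasEnds X b' c
  right : HasEnds Y c' b
  linked : Linked X a a' ∨ Linked Y a a'
  nodup : [a, a', b, b', c, c'].Nodup
  b_add_c : b + c = a + a'
  a_add_b' : a + b' = c + c'

theorem card_eq_card_mul_card_of_exact {A B C : Type*} [AddCommGroup A] [AddCommGroup B]
    [AddCommGroup C] {ι : A →+ B} {φ : B →+ C} (hι : Function.Injective ι)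
    (exact : Function.Exact ι φ) (hφ : Function.Surjective φ) :
    Nat.card B = Nat.card C * Nat.card A := by
  rw [← φ.ker.index_mul_card, AddSubgroup.index_ker, AddMonoidHom.range_eq_top.2 hφ,
    exact.addMonoidHom_ker_eq, AddSubgroup.card_top,
    Nat.card_congr (AddMonoidHom.ofInjective hι).toEquiv]

theorem add_eq_add_of_add_eq_add {A : Type*} [AddCommGroup A] {a a' b b' c c' : A}
    (h : b + c = a + a') (h' : a + b' = c + c') : a' + c' = b + b' := by
  apply add_left_cancel (a := a + c)
  calc a + c + (a' + c') = a + a' + (c + c') := add_add_add_comm ..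
    _ = b + c + (a + b') := by rw [h, h']
    _ = a + c + (b + b') := by abel

namespace Switch

variable {A B : Type*} [AddCommGroup A] [AddCommGroup B]

theorem a'_add_c' (S : Switch A) : S.a' + S.c' = S.b + S.b' :=
  add_eq_add_of_add_eq_add S.b_add_c S.a_add_b'

theorem harmonic [Finite A] (S : Switch A) : Harmonic A := S.cycle.harmonic

/-- The same switch with the roles of the two paths exchanged. -/
def rotate (S : Switch A) : Switch A where
  X := S.Y
  Y := S.X
  a := S.a'
  a' := S.a
  b := S.c
  b' := S.c'
  c := S.b
  c' := S.b'
  cycle := S.cycle.append_comm S.left S.right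
  left := S.right
  right := S.left
  linked := S.linked.symm.imp Linked.symm Linked.symm
  nodup := by
    have h := S.nodup
    simp only [List.nodup_cons, List.mem_cons, List.not_mem_nil] at h ⊢
    grind
  a_add_b' := S.a'_add_c'
  b_add_c := by rw [add_comm, S.b_add_c, add_comm]

/-- The image of a switch under an isomorphism. -/
def map (f : A ≃+ B) (S : Switch A) : Switch B where
  X := S.X.map f
  Y := S.Y.map f
  a := f S.a
  a' := f S.a'
  b := f S.b
  b' := f S.b'
  c := f S.c
  c' := f S.c'
  cycle := List.map_append ▸ S.cycle.map f
  left := S.left.map f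
  right := S.right.map f
  linked := S.linked.imp (Linked.map f) (Linked.map f)
  nodup := S.nodup.map f.injective
  b_add_c := by rw [← map_add, S.b_add_c, map_add]
  a_add_b' := by rw [← map_add, S.a_add_b', map_add]

theorem exists_linked_right (h : Nonempty (Switch A)) : ∃ S : Switch A, Linked S.Y S.a S.a' := by
  obtain ⟨S⟩ := h
  exact S.linked.elim (fun h => ⟨S.rotate, h.symm⟩) (fun h => ⟨S, h⟩)

theorem exists_rightInverse (S : Switch B) {φ : A →+ B} (hφ : Function.Surjective φ) :
    ∃ e : B → A, Function.RightInverse e φ ∧ e S.b + e S.c = e S.a + e S.a' ∧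
      e S.a + e S.b' = e S.c + e S.c' := by
  classical
  obtain ⟨e, he⟩ := hφ.hasRightInverse
  have update_apply {e : B → A} (he : Function.RightInverse e φ) {q : B} {x : A} (hx : φ x = q) :
      Function.RightInverse (Function.update e q x) φ := fun z => by
    rcases eq_or_ne z q with rfl | hz
    · rwa [Function.update_self]
    · rw [Function.update_of_ne hz, he]
  have nodup := S.nodup
  simp only [List.nodup_cons, List.mem_cons, List.not_mem_nil] at nodup
  refine ⟨_, update_apply (update_apply he (q := S.b) (x := e S.a + e S.a' - e S.c) ?_)
    (q := S.c') (x := e S.a + e S.b' - e S.c) ?_, ?_, ?_⟩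
  · simp only [map_sub, map_add, he _, ← S.b_add_c, add_sub_cancel_right]
  · simp only [map_sub, map_add, he _, S.a_add_b', add_sub_cancel_left]
  · grind [Function.update_apply]
  · grind [Function.update_apply]

/-- The choices needed to lift a switch of `B` along `φ : A →+ B` when the kernel of `φ` is the
image of the additive group of a field `F` of characteristic two under `ι`. The elements of `A`
above `q` are `sec q`, which is placed on the path `cut`, and the `sec q + ι (gen ^ r * color q)`,
one on each of `m + 3` copies of the two paths of the switch. -/
structure Layering {F : Type*} [Field F] (S : Switch B) (φ : A →+ B) (ι : F →+ A) where
  m : ℕ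
  card_eq : Nat.card F = m + 4
  gen : F
  gen_pow : gen ^ (m + 3) = 1
  exists_gen_pow : ∀ z ≠ 0, ∃ r < m + 3, gen ^ r = z
  sec : B → A
  sec_rightInverse : Function.RightInverse sec φ
  sec_b_add_c : sec S.b + sec S.c = sec S.a + sec S.a'
  sec_a_add_b' : sec S.a + sec S.b' = sec S.c + sec S.c'
  color : B → F
  color_ne_zero : ∀ q, color q ≠ 0
  color_ne : ∀ u v, Linked S.X u v ∨ Linked S.Y u v → color u ≠ color v
  color_b : color S.b = gen
  color_b' : color S.b' = gen
  color_c : color S.c = 1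
  color_c' : color S.c' = 1 + gen
  gen_mul_color_a' : gen * color S.a' = (1 + gen) * color S.a
  cut : List B
  cut_perm : cut.Perm (S.X ++ S.Y)
  cut_ends : HasEnds cut S.a S.a'
  cut_linked : ∀ u v, CyclicallyLinked (S.X ++ S.Y) u v → s(u, v) = s(S.a, S.a') ∨ Linked cut u v

namespace Layering

variable {F : Type*} [Field F] {S : Switch B} {φ : A →+ B} {ι : F →+ A} (L : Layering S φ ι)

/-- The element above `q` on the `r`-th copy of the paths of the switch. -/
def layer (r : ℕ) (q : B) : A := L.sec q + ι (L.gen ^ r * L.color q)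

/-- The `r`-th copy of the cycle of the switch, read as a path. -/
def block (r : ℕ) : List A := S.X.map (L.layer r) ++ S.Y.map (L.layer r)

/-- The consecutive copies with numbers `i, …, i + n - 1`. -/
def blocks (i n : ℕ) : List A := (List.range' i n).flatMap L.block

/-- The zeroth copy of the cycle of the switch, with the path above `cut` inserted. -/
def tail : List A :=
  (S.X.map (L.layer 0)).reverse ++ (L.cut.map L.sec ++ S.Y.map (L.layer 0))

/-- The lifted cycle. -/
def liftedCycle : List A := L.blocks 1 (L.m + 2) ++ L.tail

theorem gen_ne_zero : L.gen ≠ 0 := L.color_b ▸ L.color_ne_zero _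

theorem one_add_gen_ne_zero : 1 + L.gen ≠ 0 := L.color_c' ▸ L.color_ne_zero _

theorem exists_gen_pow_mul_eq {w z : F} (hw : w ≠ 0) (hz : z ≠ 0) :
    ∃ r < L.m + 3, L.gen ^ r * w = z := by
  obtain ⟨r, hr, h⟩ := L.exists_gen_pow (z / w) (div_ne_zero hz hw)
  exact ⟨r, hr, by rw [h, div_mul_cancel₀ z hw]⟩

theorem exists_eq_add (exact : Function.Exact ι φ) {x y : A} (h : φ x = φ y) :
    ∃ z, x = y + ι z := by
  obtain ⟨z, hz⟩ := (exact (x - y)).1 (by rw [map_sub, h, sub_self])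
  exact ⟨z, by rw [hz, add_sub_cancel]⟩

theorem layer_add_layer (r s : ℕ) (u v : B) :
    L.layer r u + L.layer s v =
      L.sec u + L.sec v + ι (L.gen ^ r * L.color u + L.gen ^ s * L.color v) := by
  rw [layer, layer, add_add_add_comm, map_add]

theorem map_layer (exact : Function.Exact ι φ) (r : ℕ) (q : B) : φ (L.layer r q) = q := by
  rw [layer, map_add, L.sec_rightInverse, exact.apply_apply_eq_zero, add_zero]

theorem hasEnds_left (r : ℕ) : HasEnds (S.X.map (L.layer r)) (L.layer r S.b') (L.layer r S.c) :=
  S.left.map _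

theorem hasEnds_right (r : ℕ) : HasEnds (S.Y.map (L.layer r)) (L.layer r S.c') (L.layer r S.b) :=
  S.right.map _

theorem hasEnds_block (r : ℕ) : HasEnds (L.block r) (L.layer r S.b') (L.layer r S.b) :=
  (L.hasEnds_left r).append (L.hasEnds_right r)

theorem hasEnds_blocks (i n : ℕ) :
    HasEnds (L.blocks i (n + 1)) (L.layer i S.b') (L.layer (i + n) S.b) :=
  hasEnds_flatMap_range' L.hasEnds_block i n

theorem hasEnds_cut_append :
    HasEnds (L.cut.map L.sec ++ S.Y.map (L.layer 0)) (L.sec S.a) (L.layer 0 S.b) :=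
  (L.cut_ends.map L.sec).append (L.hasEnds_right 0)

theorem hasEnds_tail : HasEnds L.tail (L.layer 0 S.c) (L.layer 0 S.b) :=
  (L.hasEnds_left 0).reverse.append L.hasEnds_cut_append

section Links

variable {u v : A}

theorem linked_block_iff {r : ℕ} : Linked (L.block r) u v ↔
    Linked (S.X.map (L.layer r)) u v ∨ Linked (S.Y.map (L.layer r)) u v ∨
      s(u, v) = s(L.layer r S.c, L.layer r S.c') :=
  linked_append_iff (L.hasEnds_left r) (L.hasEnds_right r)

theorem linked_tail_iff : Linked L.tail u v ↔
    Linked (S.X.map (L.layer 0)).reverse u v ∨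
      (Linked (L.cut.map L.sec) u v ∨ Linked (S.Y.map (L.layer 0)) u v ∨
        s(u, v) = s(L.sec S.a', L.layer 0 S.c')) ∨
      s(u, v) = s(L.layer 0 S.b', L.sec S.a) := by
  rw [← linked_append_iff (L.cut_ends.map L.sec) (L.hasEnds_right 0)]
  exact linked_append_iff (L.hasEnds_left 0).reverse L.hasEnds_cut_append

theorem cyclicallyLinked_liftedCycle_iff : CyclicallyLinked L.liftedCycle u v ↔
    Linked (L.blocks 1 (L.m + 2)) u v ∨ Linked L.tail u v ∨
      s(u, v) = s(L.layer (L.m + 2) S.b, L.layer 0 S.c) ∨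
      s(u, v) = s(L.layer 0 S.b, L.layer 1 S.b') := by
  have hasEnds := L.hasEnds_blocks 1 (L.m + 1)
  rw [Nat.add_comm 1] at hasEnds
  exact cyclicallyLinked_append_iff hasEnds L.hasEnds_tail

theorem cyclicallyLinked_of_linked_block {r : ℕ} (hr : r ≠ 0) (hrm : r < L.m + 3)
    (h : Linked (L.block r) u v) : CyclicallyLinked L.liftedCycle u v :=
  L.cyclicallyLinked_liftedCycle_iff.2 <| Or.inl <| h.of_infix <|
    infix_flatMap_range' (Nat.one_le_iff_ne_zero.2 hr) (by omega)

theorem cyclicallyLinked_of_linked_tail (h : Linked L.tail u v) :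
    CyclicallyLinked L.liftedCycle u v :=
  L.cyclicallyLinked_liftedCycle_iff.2 (Or.inr (Or.inl h))

theorem cyclicallyLinked_layer_of_linked {r : ℕ} (hr : r < L.m + 3) {p q : B}
    (h : Linked S.X p q ∨ Linked S.Y p q) :
    CyclicallyLinked L.liftedCycle (L.layer r p) (L.layer r q) := by
  rcases eq_or_ne r 0 with rfl | hr0
  · refine L.cyclicallyLinked_of_linked_tail (L.linked_tail_iff.2 ?_)
    exact h.imp (fun h => (h.map _).reverse) fun h => Or.inl (Or.inr (Or.inl (h.map _)))
  · refine L.cyclicallyLinked_of_linked_block hr0 hr (L.linked_block_iff.2 ?_)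
    exact h.imp (Linked.map _) fun h => Or.inl (h.map _)

theorem cyclicallyLinked_layer_c_c' {r : ℕ} (hr : r ≠ 0) (hrm : r < L.m + 3) :
    CyclicallyLinked L.liftedCycle (L.layer r S.c) (L.layer r S.c') :=
  L.cyclicallyLinked_of_linked_block hr hrm (L.linked_block_iff.2 (Or.inr (Or.inr rfl)))

theorem cyclicallyLinked_layer_b_b' {r : ℕ} (hr : r < L.m + 2) :
    CyclicallyLinked L.liftedCycle (L.layer r S.b) (L.layer (r + 1) S.b') := by
  rw [cyclicallyLinked_liftedCycle_iff]
  rcases eq_or_ne r 0 with rfl | hr0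
  · exact Or.inr (Or.inr (Or.inr rfl))
  · exact Or.inl (linked_flatMap_range' L.hasEnds_block (Nat.one_le_iff_ne_zero.2 hr0) (by omega))

end Links

section Sums

theorem exists_sum_eq_b_b' {z : F} (hz : z ≠ 0) :
    ∃ p q, CyclicallyLinked L.liftedCycle p q ∧ p + q = L.sec S.b + L.sec S.b' + ι z := by
  obtain ⟨r, hr, rfl⟩ :=
    L.exists_gen_pow_mul_eq (mul_ne_zero L.gen_ne_zero L.one_add_gen_ne_zero) hz
  rcases Nat.lt_succ_iff_lt_or_eq.1 hr with hr | rfl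
  · refine ⟨_, _, L.cyclicallyLinked_layer_b_b' hr, ?_⟩
    rw [layer_add_layer, color_b, color_b']
    congr 2
    ring
  · refine ⟨_, _, L.cyclicallyLinked_of_linked_tail
      (L.linked_tail_iff.2 (Or.inr (Or.inl (Or.inr (Or.inr rfl))))), ?_⟩
    rw [layer, color_c', pow_zero, one_mul, ← add_assoc, ← mul_assoc, ← pow_succ, L.gen_pow,
      one_mul, add_eq_add_of_add_eq_add L.sec_b_add_c L.sec_a_add_b']

variable [CharP F 2]

theorem exists_sum_eq_sec_add_sec {u v : B} (h : CyclicallyLinked (S.X ++ S.Y) u v) :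
    ∃ p q, CyclicallyLinked L.liftedCycle p q ∧ p + q = L.sec u + L.sec v := by
  rcases L.cut_linked u v h with huv | h
  · refine ⟨_, _, L.cyclicallyLinked_liftedCycle_iff.2 (Or.inr (Or.inr (Or.inl rfl))), ?_⟩
    rw [layer_add_layer, color_b, color_c, ← pow_succ, L.gen_pow, pow_zero, mul_one,
      CharTwo.add_self_eq_zero, map_zero, add_zero, L.sec_b_add_c]
    exact (congrArg (edgeLabel L.sec) huv).symm
  · exact ⟨_, _, L.cyclicallyLinked_of_linked_tail
      (L.linked_tail_iff.2 (Or.inr (Or.inl (Or.inl (h.map _))))), rfl⟩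

theorem exists_sum_eq_of_linked {u v : B} (h : Linked S.X u v ∨ Linked S.Y u v) {z : F}
    (hz : z ≠ 0) :
    ∃ p q, CyclicallyLinked L.liftedCycle p q ∧ p + q = L.sec u + L.sec v + ι z := by
  have color_add_ne : L.color u + L.color v ≠ 0 := mt CharTwo.add_eq_zero.1 (L.color_ne u v h)
  obtain ⟨r, hr, rfl⟩ := L.exists_gen_pow_mul_eq color_add_ne hz
  exact ⟨_, _, L.cyclicallyLinked_layer_of_linked hr h, by rw [layer_add_layer, mul_add]⟩

theorem exists_sum_eq_c_c' {z : F} (hz : z ≠ 0) :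
    ∃ p q, CyclicallyLinked L.liftedCycle p q ∧ p + q = L.sec S.c + L.sec S.c' + ι z := by
  obtain ⟨r, hr, rfl⟩ := L.exists_gen_pow_mul_eq L.gen_ne_zero hz
  rcases eq_or_ne r 0 with rfl | hr0
  · refine ⟨_, _, L.cyclicallyLinked_of_linked_tail (L.linked_tail_iff.2 (Or.inr (Or.inr rfl))), ?_⟩
    rw [layer, color_b', add_comm, ← add_assoc, L.sec_a_add_b']
  · refine ⟨_, _, L.cyclicallyLinked_layer_c_c' hr0 hr, ?_⟩
    rw [layer_add_layer, color_c, color_c', ← mul_add, ← add_assoc, CharTwo.add_self_eq_zero,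
      zero_add]

theorem exists_sum_eq {u v : B} (h : CyclicallyLinked (S.X ++ S.Y) u v) (z : F) :
    ∃ p q, CyclicallyLinked L.liftedCycle p q ∧ p + q = L.sec u + L.sec v + ι z := by
  rcases eq_or_ne z 0 with rfl | hz
  · simpa only [map_zero, add_zero] using L.exists_sum_eq_sec_add_sec h
  · rcases (cyclicallyLinked_append_iff S.left S.right).1 h with h | h | h | h
    · exact L.exists_sum_eq_of_linked (Or.inl h) hz
    · exact L.exists_sum_eq_of_linked (Or.inr h) hz
    · rw [show L.sec u + L.sec v = L.sec S.c + L.sec S.c' from congrArg (edgeLabel L.sec) h]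
      exact L.exists_sum_eq_c_c' hz
    · rw [show L.sec u + L.sec v = L.sec S.b + L.sec S.b' from congrArg (edgeLabel L.sec) h]
      exact L.exists_sum_eq_b_b' hz

end Sums

theorem length_block (r : ℕ) : (L.block r).length = Nat.card B := by
  rw [block, List.length_append, List.length_map, List.length_map, ← List.length_append,
    S.cycle.length_eq]

theorem length_liftedCycle : L.liftedCycle.length = Nat.card B * Nat.card F := by
  have length_tail : L.tail.length = Nat.card B + Nat.card B := by
    have cut_length := L.cut_perm.length_eq.trans S.cycle.length_eq
    have length_eq := S.cycle.length_eq
    rw [List.length_append] at length_eq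
    simp only [tail, List.length_append, List.length_reverse, List.length_map]
    omega
  rw [liftedCycle, List.length_append, length_tail, blocks, List.length_flatMap, L.card_eq]
  simp only [length_block, List.map_const', List.length_range', List.sum_replicate, smul_eq_mul]
  ring

theorem layer_mem_liftedCycle {r : ℕ} (hr : r < L.m + 3) (q : B) :
    L.layer r q ∈ L.liftedCycle := by
  have mem_paths := List.mem_append.1 (S.cycle.mem q)
  rw [liftedCycle, List.mem_append]
  rcases eq_or_ne r 0 with rfl | hr0
  · simp only [tail, List.mem_append, List.mem_reverse]
    exact Or.inr (mem_paths.imp List.mem_map_of_mem fun h => Or.inr (List.mem_map_of_mem h))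
  · refine Or.inl ((infix_flatMap_range' (Nat.one_le_iff_ne_zero.2 hr0) (by omega)).subset ?_)
    exact List.mem_append.2 (mem_paths.imp List.mem_map_of_mem List.mem_map_of_mem)

theorem sec_mem_liftedCycle (q : B) : L.sec q ∈ L.liftedCycle := by
  simp only [liftedCycle, tail, List.mem_append]
  exact Or.inr (Or.inr (Or.inl (List.mem_map_of_mem (L.cut_perm.mem_iff.2 (S.cycle.mem q)))))

theorem isHarmonicCycle_liftedCycle [CharP F 2] (exact : Function.Exact ι φ)
    (hι : Function.Injective ι) : IsHarmonicCycle L.liftedCycle where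
  length_eq := by
    rw [length_liftedCycle,
      card_eq_card_mul_card_of_exact hι exact L.sec_rightInverse.surjective]
  mem x := by
    obtain ⟨q, z, rfl⟩ : ∃ q z, x = L.sec q + ι z :=
      ⟨φ x, exists_eq_add exact (L.sec_rightInverse _).symm⟩
    rcases eq_or_ne z 0 with rfl | hz
    · simpa only [map_zero, add_zero] using L.sec_mem_liftedCycle q
    · obtain ⟨r, hr, rfl⟩ := L.exists_gen_pow_mul_eq (L.color_ne_zero q) hz
      exact L.layer_mem_liftedCycle hr q
  sum y := by
    obtain ⟨u, v, huv, hy⟩ := S.cycle.sum (φ y)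
    obtain ⟨z, rfl⟩ : ∃ z, y = L.sec u + L.sec v + ι z :=
      exists_eq_add exact (by rw [map_add, L.sec_rightInverse, L.sec_rightInverse, hy])
    exact L.exists_sum_eq huv z

/-- The first path of the lifted switch. -/
def newX : List A := S.X.map (L.layer 1) ++ (S.Y.map (L.layer 1) ++ S.X.map (L.layer 2))

/-- The second path of the lifted switch. -/
def newY : List A := S.Y.map (L.layer 2) ++ (L.blocks 3 L.m ++ L.tail)

theorem newX_append_newY : L.newX ++ L.newY = L.liftedCycle := by
  rw [liftedCycle, blocks, Nat.add_comm L.m 2, ← List.range'_append_1, List.flatMap_append]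
  simp only [newX, newY, blocks, block, List.range'_succ, List.range'_zero, List.flatMap_cons,
    List.flatMap_nil, List.append_assoc, List.append_nil]

theorem hasEnds_newX : HasEnds L.newX (L.layer 1 S.b') (L.layer 2 S.c) :=
  (L.hasEnds_left 1).append ((L.hasEnds_right 1).append (L.hasEnds_left 2))

theorem hasEnds_newY : HasEnds L.newY (L.layer 2 S.c') (L.layer 0 S.b) where
  head := by rw [newY, List.head?_append, (L.hasEnds_right 2).head, Option.some_or]
  last := by
    rw [newY, List.getLast?_append, List.getLast?_append, L.hasEnds_tail.last, Option.some_or,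
      Option.some_or]

theorem linked_newX_or_newY (exact : Function.Exact ι φ) {r : ℕ} (hr : r < L.m + 3) :
    Linked L.newX (L.layer r S.a) (L.layer r S.a') ∨
      Linked L.newY (L.layer r S.a) (L.layer r S.a') := by
  have linked := L.cyclicallyLinked_layer_of_linked hr S.linked
  rw [← newX_append_newY, cyclicallyLinked_append_iff L.hasEnds_newX L.hasEnds_newY] at linked
  have nodup := S.nodup
  simp only [List.nodup_cons, List.mem_cons, List.not_mem_nil] at nodup
  have ends_eq {s t : ℕ} {p q : B} (h : s(L.layer r S.a, L.layer r S.a') =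
      s(L.layer s p, L.layer t q)) : s(S.a, S.a') = s(p, q) := by
    simpa only [Sym2.map_mk, L.map_layer exact] using congrArg (Sym2.map φ) h
  rcases linked with h | h | h | h
  · exact Or.inl h
  · exact Or.inr h
  · grind [Sym2.eq_iff.1 (ends_eq h)]
  · grind [Sym2.eq_iff.1 (ends_eq h)]

theorem nodup_layers (exact : Function.Exact ι φ) (r : ℕ) :
    [L.layer r S.a, L.layer r S.a', L.layer 0 S.b, L.layer 1 S.b', L.layer 2 S.c,
      L.layer 2 S.c'].Nodup := by
  refine List.Nodup.of_map φ ?_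
  simpa only [List.map_cons, List.map_nil, L.map_layer exact] using S.nodup

theorem exists_gen_pow_mul_color_a : ∃ r < L.m + 3,
    L.gen ^ r * L.color S.a = L.gen ^ 2 * (1 + L.gen) ∧
      L.gen ^ r * L.color S.a' = L.gen * (1 + L.gen) ^ 2 := by
  obtain ⟨r, hr, h⟩ := L.exists_gen_pow_mul_eq (L.color_ne_zero S.a)
    (mul_ne_zero (pow_ne_zero 2 L.gen_ne_zero) L.one_add_gen_ne_zero)
  refine ⟨r, hr, h, mul_left_cancel₀ L.gen_ne_zero ?_⟩
  linear_combination L.gen ^ r * L.gen_mul_color_a' + (1 + L.gen) * h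

theorem nonempty_switch (L : Layering S φ ι) [CharP F 2] (exact : Function.Exact ι φ)
    (hι : Function.Injective ι) : Nonempty (Switch A) := by
  obtain ⟨r, hr, color_a, color_a'⟩ := L.exists_gen_pow_mul_color_a
  exact ⟨{
    X := L.newX
    Y := L.newY
    a := L.layer r S.a
    a' := L.layer r S.a'
    b := L.layer 0 S.b
    b' := L.layer 1 S.b'
    c := L.layer 2 S.c
    c' := L.layer 2 S.c'
    cycle := L.newX_append_newY ▸ L.isHarmonicCycle_liftedCycle exact hι
    left := L.hasEnds_newX
    right := L.hasEnds_newY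
    linked := L.linked_newX_or_newY exact hr
    nodup := L.nodup_layers exact r
    b_add_c := by
      rw [layer_add_layer, layer_add_layer, L.sec_b_add_c, color_a, color_a', L.color_b, L.color_c]
      congr 2
      linear_combination (-L.gen ^ 2 - L.gen ^ 3) * CharTwo.two_eq_zero (R := F)
    a_add_b' := by
      rw [layer_add_layer, layer_add_layer, L.sec_a_add_b', color_a, L.color_b', L.color_c,
        L.color_c']
      congr 2
      ring }⟩

end Layering

end Switch

theorem exists_units_pow_eq {F : Type*} [Field F] [Finite F] {n : ℕ}
    (card_eq : Nat.card F = n + 1) :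
    ∃ u : Fˣ, orderOf u = n ∧ ∀ z : F, z ≠ 0 → ∃ r < n, (u : F) ^ r = z := by
  classical
  obtain ⟨u, hu⟩ := IsCyclic.exists_generator (α := Fˣ)
  have orderOf_eq : orderOf u = n := by
    rw [orderOf_eq_card_of_forall_mem_zpowers hu, Nat.card_units, card_eq, Nat.add_sub_cancel]
  refine ⟨u, orderOf_eq, fun z hz => ?_⟩
  obtain ⟨r, hr, h⟩ := Finset.mem_image.1
    ((isOfFinOrder_of_finite u).mem_zpowers_iff_mem_range_orderOf.1 (hu (Units.mk0 z hz)))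
  exact ⟨r, orderOf_eq ▸ Finset.mem_range.1 hr, congrArg Units.val h⟩

theorem exists_galoisField_addEquiv {K : Type*} [AddCommGroup K] [Finite K] [Nontrivial K]
    (hK : ∀ x : K, x + x = 0) : ∃ k, Nonempty (GaloisField 2 k ≃+ K) := by
  let _ : Module (ZMod 2) K := AddCommGroup.zmodModule (n := 2) fun x => by rw [two_nsmul, hK]
  have finrank_ne_zero : Module.finrank (ZMod 2) K ≠ 0 := Module.finrank_pos.ne'
  exact ⟨_, ⟨(LinearEquiv.ofFinrankEq (GaloisField 2 _) K
    (GaloisField.finrank 2 finrank_ne_zero)).toAddEquiv⟩⟩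

namespace Switch

variable {A B : Type*} [AddCommGroup A] [AddCommGroup B]

theorem exists_coloring_right [Finite B] {κ : Type*} [CommGroup κ] (hκ : 3 ≤ ENat.card κ)
    (S : Switch B) (linked : Linked S.Y S.a S.a') {β γ : κ} (hβγ : β ≠ γ) :
    ∃ g : B → κ, g S.c' = γ ∧ g S.b = β ∧ β * g S.a' = γ * g S.a ∧
      ∀ u v, Linked S.Y u v → g u ≠ g v := by
  have nodup_Y := (List.nodup_append'.1 S.cycle.nodup).2.1
  have nodup := S.nodup
  simp only [List.nodup_cons, List.mem_cons, List.not_mem_nil] at nodup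
  rcases linked with infix_Y | infix_Y
  · obtain ⟨τ, hτ, hτ'⟩ := ENat.exists_ne_ne_of_three_le hκ (γ * β⁻¹) (β * γ⁻¹)
    obtain ⟨g, hc', hb, ha, ha', hg⟩ := exists_path_coloring_of_pair_infix hκ nodup_Y S.right
      infix_Y (s := γ) (t := β) (p := τ * β) (q := τ * γ)
      (iff_of_false (by grind) fun h => hτ (eq_mul_inv_of_mul_eq h.symm))
      (iff_of_false (by grind) fun h => hτ' (eq_mul_inv_of_mul_eq h))
      (mt mul_left_cancel hβγ)
    exact ⟨g, hc', hb, by rw [ha, ha', mul_left_comm, mul_left_comm γ, mul_comm γ], hg⟩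
  · obtain ⟨τ, hτ, -⟩ := ENat.exists_ne_ne_of_three_le hκ 1 1
    obtain ⟨g, hc', hb, ha', ha, hg⟩ := exists_path_coloring_of_pair_infix hκ nodup_Y S.right
      infix_Y (s := γ) (t := β) (p := τ * γ) (q := τ * β)
      (iff_of_false (by grind) fun h => hτ (right_eq_mul.1 h))
      (iff_of_false (by grind) fun h => hτ (mul_eq_right.1 h))
      (mt mul_left_cancel hβγ.symm)
    exact ⟨g, hc', hb, by rw [ha, ha', mul_left_comm, mul_left_comm γ, mul_comm γ], hg⟩

theorem exists_coloring [Finite B] {κ : Type*} [CommGroup κ] (hκ : 3 ≤ ENat.card κ)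
    (S : Switch B) (linked : Linked S.Y S.a S.a') {β γ : κ} (hβ : β ≠ 1) (hβγ : β ≠ γ) :
    ∃ g : B → κ, g S.b = β ∧ g S.b' = β ∧ g S.c = 1 ∧ g S.c' = γ ∧ β * g S.a' = γ * g S.a ∧
      ∀ u v, Linked S.X u v ∨ Linked S.Y u v → g u ≠ g v := by
  obtain ⟨nodup_X, -, disjoint⟩ := List.nodup_append'.1 S.cycle.nodup
  have b'_ne_c : S.b' ≠ S.c := by
    have nodup := S.nodup
    simp only [List.nodup_cons, List.mem_cons, List.not_mem_nil] at nodup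
    grind
  obtain ⟨g₁, hb', hc, hg₁⟩ := exists_path_coloring hκ nodup_X S.left (iff_of_false b'_ne_c hβ)
  obtain ⟨g₂, hc', hb, ha, hg₂⟩ := S.exists_coloring_right hκ linked hβγ
  obtain ⟨g, eq_left, eq_right⟩ := exists_eq_on_of_disjoint disjoint g₁ g₂
  refine ⟨g, ?_, ?_, ?_, ?_, ?_, ?_⟩
  · rw [eq_right _ S.right.right_mem, hb]
  · rw [eq_left _ S.left.left_mem, hb']
  · rw [eq_left _ S.left.right_mem, hc]
  · rw [eq_right _ S.right.left_mem, hc']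
  · rw [eq_right _ linked.left_mem, eq_right _ linked.right_mem, ha]
  · rintro u v (h | h)
    · simpa only [eq_left _ h.left_mem, eq_left _ h.right_mem] using hg₁ u v h
    · simpa only [eq_right _ h.left_mem, eq_right _ h.right_mem] using hg₂ u v h

theorem nonempty_layering [Finite B] {F : Type*} [Field F] [Finite F] [CharP F 2]
    (hF : 4 ≤ Nat.card F) (S : Switch B) (linked : Linked S.Y S.a S.a') {φ : A →+ B}
    (hφ : Function.Surjective φ) (ι : F →+ A) : Nonempty (Layering S φ ι) := by
  obtain ⟨m, hm⟩ := Nat.exists_eq_add_of_le' hF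
  have card_units : 3 ≤ ENat.card Fˣ := by
    rw [ENat.card_eq_coe_natCard, Nat.card_units]
    exact_mod_cast Nat.le_sub_one_of_lt hF
  obtain ⟨β, orderOf_β, exists_β_pow⟩ := exists_units_pow_eq hm
  have hβ : β ≠ 1 := fun h => absurd (orderOf_β ▸ orderOf_eq_one_iff.2 h) (by omega)
  let γ : Fˣ := Units.mk0 (1 + β) fun h => hβ (Units.ext (CharTwo.add_eq_zero.1 h).symm)
  have hβγ : β ≠ γ := fun h => one_ne_zero (right_eq_add.1 (congrArg Units.val h))
  obtain ⟨g, hb, hb', hc, hc', ha, hg⟩ := S.exists_coloring card_units linked hβ hβγ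
  obtain ⟨e, he, hebc, heab'⟩ := S.exists_rightInverse hφ
  have linked_cycle : Linked (S.X ++ S.Y) S.a S.a' :=
    linked.of_infix (List.suffix_append _ _).isInfix
  obtain ⟨cut, cut_perm, cut_ends, cut_linked⟩ := linked_cycle.exists_cut
  exact ⟨{
    m := m
    card_eq := hm
    gen := β
    gen_pow := congrArg Units.val (orderOf_β ▸ pow_orderOf_eq_one β)
    exists_gen_pow := exists_β_pow
    sec := e
    sec_rightInverse := he
    sec_b_add_c := hebc
    sec_a_add_b' := heab'
    color := fun q => g q
    color_ne_zero := fun q => (g q).ne_zero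
    color_ne := fun u v huv => mt Units.ext (hg u v huv)
    color_b := congrArg _ hb
    color_b' := congrArg _ hb'
    color_c := congrArg _ hc
    color_c' := congrArg _ hc'
    gen_mul_color_a' := congrArg Units.val ha
    cut := cut
    cut_perm := cut_perm
    cut_ends := cut_ends
    cut_linked := cut_linked }⟩

theorem nonempty_of_surjective [Finite A] {φ : A →+ B} (hφ : Function.Surjective φ)
    (ker_add_self : ∀ x ∈ φ.ker, x + x = 0) (card_ker : 4 ≤ Nat.card φ.ker)
    (hB : Nonempty (Switch B)) : Nonempty (Switch A) := by
  have : Nontrivial φ.ker := Finite.one_lt_card_iff_nontrivial.1 (by omega)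
  obtain ⟨k, ⟨f⟩⟩ := exists_galoisField_addEquiv (K := φ.ker) fun x =>
    Subtype.ext (ker_add_self x x.2)
  have : Finite (GaloisField 2 k) := Finite.of_equiv _ f.symm.toEquiv
  rw [← Nat.card_congr f.toEquiv] at card_ker
  let ι : GaloisField 2 k →+ A := φ.ker.subtype.comp f.toAddMonoidHom
  have hι : Function.Injective ι := Subtype.val_injective.comp f.injective
  have exact_ι : Function.Exact ι φ := fun x =>
    ⟨fun hx => ⟨f.symm ⟨x, hx⟩, congrArg Subtype.val (f.apply_symm_apply _)⟩, by
      rintro ⟨z, rfl⟩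
      exact (f z).2⟩
  have : Finite B := Finite.of_surjective φ hφ
  obtain ⟨S, linked⟩ := exists_linked_right hB
  obtain ⟨L⟩ := S.nonempty_layering card_ker linked hφ ι
  exact L.nonempty_switch exact_ι hι

end Switch

namespace Switch

theorem nonempty_two_four : Nonempty (Switch (ZMod 2 × ZMod 4)) := ⟨{
  X := [(1, 1), (1, 2), (1, 0)]
  Y := [(0, 2), (0, 3), (0, 1), (1, 3), (0, 0)]
  a := (0, 1)
  a' := (1, 3)
  b := (0, 0)
  b' := (1, 1)
  c := (1, 0)
  c' := (0, 2)
  cycle := .of_mem_zip (by simp) (by decide) (by decide)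
  left := ⟨rfl, rfl⟩
  right := ⟨rfl, rfl⟩
  linked := Or.inr (Or.inl (by decide))
  nodup := by decide
  b_add_c := by decide
  a_add_b' := by decide }⟩

theorem nonempty_four_four : Nonempty (Switch (ZMod 4 × ZMod 4)) := ⟨{
  X := [(0, 2), (1, 1), (0, 3), (2, 1)]
  Y := [(2, 2), (3, 0), (1, 0), (1, 2), (3, 3), (0, 1), (2, 0), (1, 3), (2, 3), (3, 2), (3, 1),
    (0, 0)]
  a := (0, 1)
  a' := (2, 0)
  b := (0, 0)
  b' := (0, 2)
  c := (2, 1)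
  c' := (2, 2)
  cycle := .of_mem_zip (by simp) (by decide) (by decide)
  left := ⟨rfl, rfl⟩
  right := ⟨rfl, rfl⟩
  linked := Or.inr (Or.inl (by decide))
  nodup := by decide
  b_add_c := by decide
  a_add_b' := by decide }⟩

theorem nonempty_two_two_four : Nonempty (Switch (ZMod 2 × ZMod 2 × ZMod 4)) := ⟨{
  X := [(1, 0, 1), (1, 0, 2), (1, 1, 0), (1, 1, 1), (1, 1, 3), (0, 1, 3), (1, 1, 2)]
  Y := [(0, 0, 1), (0, 1, 0), (1, 0, 0), (0, 1, 2), (1, 0, 3), (0, 0, 0), (0, 0, 2), (0, 1, 1),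
    (0, 0, 3)]
  a := (0, 1, 2)
  a' := (1, 0, 3)
  b := (0, 0, 3)
  b' := (1, 0, 1)
  c := (1, 1, 2)
  c' := (0, 0, 1)
  cycle := .of_mem_zip (by simp) (by decide) (by decide)
  left := ⟨rfl, rfl⟩
  right := ⟨rfl, rfl⟩
  linked := Or.inr (Or.inl (by decide))
  nodup := by decide
  b_add_c := by decide
  a_add_b' := by decide }⟩

theorem nonempty_two_two_three : Nonempty (Switch (ZMod 2 × ZMod 2 × ZMod 3)) := ⟨{
  X := [(1, 1, 0), (1, 0, 0)]
  Y := [(0, 1, 2), (0, 1, 0), (0, 1, 1), (0, 0, 1), (1, 0, 1), (0, 0, 2), (1, 0, 2), (1, 1, 2),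
    (1, 1, 1), (0, 0, 0)]
  a := (0, 0, 2)
  a' := (1, 0, 1)
  b := (0, 0, 0)
  b' := (1, 1, 0)
  c := (1, 0, 0)
  c' := (0, 1, 2)
  cycle := .of_mem_zip (by simp) (by decide) (by decide)
  left := ⟨rfl, rfl⟩
  right := ⟨rfl, rfl⟩
  linked := Or.inr (Or.inr (by decide))
  nodup := by decide
  b_add_c := by decide
  a_add_b' := by decide }⟩

theorem nonempty_two_two_five : Nonempty (Switch (ZMod 2 × ZMod 2 × ZMod 5)) := ⟨{
  X := [(0, 0, 4), (1, 1, 3), (1, 1, 1), (0, 0, 3), (0, 1, 3), (1, 0, 2), (0, 1, 1), (0, 1, 2),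
    (0, 1, 4), (1, 1, 0)]
  Y := [(1, 0, 4), (1, 1, 4), (1, 0, 3), (1, 1, 2), (0, 1, 0), (1, 0, 1), (0, 0, 2), (0, 0, 0),
    (1, 0, 0), (0, 0, 1)]
  a := (0, 1, 0)
  a' := (1, 0, 1)
  b := (0, 0, 1)
  b' := (0, 0, 4)
  c := (1, 1, 0)
  c' := (1, 0, 4)
  cycle := .of_mem_zip (by simp) (by decide) (by decide)
  left := ⟨rfl, rfl⟩
  right := ⟨rfl, rfl⟩
  linked := Or.inr (Or.inl (by decide))
  nodup := by decide
  b_add_c := by decide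
  a_add_b' := by decide }⟩

end Switch

theorem isHarmonicCycle_two_two_two_three : IsHarmonicCycle (A := ZMod 2 × ZMod 2 × ZMod 2 × ZMod 3)
    [(0, 0, 0, 0), (1, 1, 1, 0), (0, 0, 0, 2), (1, 1, 0, 2), (0, 1, 1, 2), (0, 0, 1, 0),
      (1, 0, 0, 2), (1, 0, 1, 1), (1, 0, 1, 0), (0, 0, 1, 2), (0, 1, 0, 0), (0, 1, 0, 2),
      (0, 1, 0, 1), (1, 1, 1, 2), (1, 0, 0, 1), (0, 1, 1, 0), (1, 1, 1, 1), (1, 1, 0, 0),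
      (1, 0, 0, 0), (1, 1, 0, 1), (0, 0, 0, 1), (0, 0, 1, 1), (1, 0, 1, 2), (0, 1, 1, 1)] :=
  .of_mem_zip (by simp) (by decide) (by decide)

set_option maxRecDepth 4000 in
theorem isHarmonicCycle_two_two_two_five : IsHarmonicCycle (A := ZMod 2 × ZMod 2 × ZMod 2 × ZMod 5)
    [(0, 0, 0, 0), (0, 0, 0, 1), (1, 1, 0, 1), (1, 0, 1, 0), (0, 1, 1, 4), (0, 0, 1, 2),
      (0, 0, 1, 1), (1, 0, 1, 2), (1, 1, 0, 3), (1, 1, 0, 2), (1, 1, 1, 4), (1, 1, 0, 4),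
      (0, 1, 0, 2), (1, 0, 0, 1), (1, 0, 1, 3), (1, 0, 0, 4), (0, 0, 1, 0), (1, 0, 0, 3),
      (0, 1, 0, 3), (1, 1, 1, 3), (1, 0, 1, 4), (0, 1, 0, 1), (0, 0, 0, 2), (0, 1, 1, 0),
      (0, 0, 0, 4), (0, 0, 0, 3), (1, 1, 1, 0), (0, 1, 1, 2), (1, 0, 0, 0), (1, 1, 0, 0),
      (0, 0, 1, 4), (1, 1, 1, 1), (1, 0, 0, 2), (0, 0, 1, 3), (1, 0, 1, 1), (0, 1, 0, 0),
      (1, 1, 1, 2), (0, 1, 1, 3), (0, 1, 1, 1), (0, 1, 0, 4)] :=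
  .of_mem_zip (by simp) (by decide) (by decide)

/-- Modulo `2 • e`, the list `P ++ S` is a harmonic cycle, and modulo `e` both of its halves `P`
and `S` run through the same elements. The halves have ends `x`, `y` and `x + e`, `z`, which makes
it possible to pass from `e` to `2 • e`. -/
structure IsDoublingCycle {M : Type*} [AddCommGroup M] (e : M) (P S : List M) (x y z : M) :
    Prop where
  perm : S.Perm (P.map (· + e))
  left : HasEnds P x y
  right : HasEnds S (x + e) z
  mem : ∀ w, ∃ u ∈ P ++ S, ∃ k : ℤ, w = u + k • (2 • e)
  sum : ∀ w, ∃ u v, CyclicallyLinked (P ++ S) u v ∧ ∃ k : ℤ, w = u + v + k • (2 • e)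

namespace IsDoublingCycle

variable {M : Type*} [AddCommGroup M] {e x y z u v : M} {P S : List M}

/-- The second half of the doubled cycle, whose first half is `P ++ S`. -/
def shift (e : M) (P S : List M) : List M := S.map (· + e) ++ P.map (· + 3 • e)

theorem shift_perm (h : IsDoublingCycle e P S x y z) :
    (shift e P S).Perm ((P ++ S).map (· + 2 • e)) := by
  have perm_left := h.perm.map (· + e)
  have perm_right := (h.perm.map (· + 2 • e)).symm
  rw [List.map_map] at perm_left perm_right
  rw [List.map_append]
  refine (perm_left.trans (.of_eq ?_)).append (.trans (.of_eq ?_) perm_right) <;>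
    exact List.map_congr_left fun w _ => by simp only [Function.comp_apply]; module

theorem hasEnds_shift (h : IsDoublingCycle e P S x y z) :
    HasEnds (shift e P S) (x + e + e) (y + 3 • e) :=
  (h.right.map _).append (h.left.map _)

theorem cyclicallyLinked_append_shift_iff (h : IsDoublingCycle e P S x y z) :
    CyclicallyLinked (P ++ S ++ shift e P S) u v ↔
      (Linked P u v ∨ Linked S u v ∨ s(u, v) = s(y, x + e)) ∨
        (Linked (S.map (· + e)) u v ∨ Linked (P.map (· + 3 • e)) u v ∨
          s(u, v) = s(z + e, x + 3 • e)) ∨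
        s(u, v) = s(z, x + e + e) ∨ s(u, v) = s(y + 3 • e, x) := by
  rw [cyclicallyLinked_append_iff (h.left.append h.right) h.hasEnds_shift,
    linked_append_iff h.left h.right, shift, linked_append_iff (h.right.map _) (h.left.map _)]

theorem exists_sum_eq (h : IsDoublingCycle e P S x y z) (huv : CyclicallyLinked (P ++ S) u v)
    (k : ℤ) : ∃ p q, CyclicallyLinked (P ++ S ++ shift e P S) p q ∧
      ∃ j : ℤ, u + v + k • (2 • e) = p + q + j • (2 • (2 • e)) := by
  have add_eq {p q r s : M} (h : s(p, q) = s(r, s)) : p + q = r + s := congrArg (edgeLabel id) h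
  simp only [h.cyclicallyLinked_append_shift_iff]
  obtain ⟨j, rfl | rfl⟩ := Int.even_or_odd' k <;>
    rcases (cyclicallyLinked_append_iff h.left h.right).1 huv with huv | huv | huv | huv
  · exact ⟨u, v, Or.inl (Or.inl huv), j, by module⟩
  · exact ⟨u, v, Or.inl (Or.inr (Or.inl huv)), j, by module⟩
  · exact ⟨y, x + e, Or.inl (Or.inr (Or.inr rfl)), j, by rw [add_eq huv]; module⟩
  · exact ⟨z + e, x + 3 • e, Or.inr (Or.inl (Or.inr (Or.inr rfl))), j - 1, by
      rw [add_eq huv]; module⟩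
  · exact ⟨u + 3 • e, v + 3 • e, Or.inr (Or.inl (Or.inr (Or.inl (huv.map _)))), j - 1, by module⟩
  · exact ⟨u + e, v + e, Or.inr (Or.inl (Or.inl (huv.map _))), j, by module⟩
  · exact ⟨y + 3 • e, x, Or.inr (Or.inr (Or.inr rfl)), j, by rw [add_eq huv]; module⟩
  · exact ⟨z, x + e + e, Or.inr (Or.inr (Or.inl rfl)), j, by rw [add_eq huv]; module⟩

theorem double (h : IsDoublingCycle e P S x y z) :
    IsDoublingCycle (2 • e) (P ++ S) (shift e P S) x z (y + 3 • e) where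
  perm := h.shift_perm
  left := h.left.append h.right
  right := by
    rw [two_nsmul, ← add_assoc]
    exact h.hasEnds_shift
  mem w := by
    obtain ⟨u, hu, k, rfl⟩ := h.mem w
    obtain ⟨j, rfl | rfl⟩ := Int.even_or_odd' k
    · exact ⟨u, List.mem_append_left _ hu, j, by module⟩
    · exact ⟨u + 2 • e, List.mem_append_right _ (h.shift_perm.mem_iff.2 (List.mem_map_of_mem hu)),
        j, by module⟩
  sum w := by
    obtain ⟨u, v, huv, k, rfl⟩ := h.sum w
    exact h.exists_sum_eq huv k

theorem isHarmonicCycle_map {A : Type*} [AddCommGroup A] {π : M →+ A}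
    (h : IsDoublingCycle e P S x y z) (hπ : Function.Surjective π) (map_eq_zero : π (2 • e) = 0)
    (card_eq : Nat.card A = 2 * P.length) : IsHarmonicCycle ((P ++ S).map π) where
  length_eq := by
    rw [List.length_map, List.length_append, h.perm.length_eq, List.length_map, card_eq, two_mul]
  mem w := by
    obtain ⟨w, rfl⟩ := hπ w
    obtain ⟨u, hu, k, rfl⟩ := h.mem w
    rw [map_add, map_zsmul, map_eq_zero, smul_zero, add_zero]
    exact List.mem_map_of_mem hu
  sum w := by
    obtain ⟨w, rfl⟩ := hπ w
    obtain ⟨u, v, huv, k, rfl⟩ := h.sum w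
    exact ⟨π u, π v, huv.map π, by
      rw [map_add, map_zsmul, map_eq_zero, smul_zero, add_zero, map_add]⟩

end IsDoublingCycle

theorem exists_mem_eq_add_zsmul {n : ℕ} {l : List (ZMod 2 × ℤ)} {e : ZMod 2 × ℤ}
    (he : e = (0, (n : ℤ)))
    (h : ∀ w : ZMod 2 × ZMod n, w ∈ l.map (Prod.map id Int.cast)) (w : ZMod 2 × ℤ) :
    ∃ u ∈ l, ∃ k : ℤ, w = u + k • e := by
  obtain ⟨u, hu, huw⟩ := List.mem_map.1 (h (Prod.map id Int.cast w))
  obtain ⟨fst_eq, snd_eq⟩ := Prod.ext_iff.1 huw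
  obtain ⟨k, hk⟩ := (ZMod.intCast_eq_intCast_iff_dvd_sub _ _ _).1 snd_eq
  refine ⟨u, hu, k, Prod.ext ?_ ?_⟩
  · simpa [he] using fst_eq.symm
  · simpa [he, mul_comm k, sub_eq_iff_eq_add'] using hk

theorem exists_cyclicallyLinked_eq_add_zsmul {n : ℕ} {x : ZMod 2 × ℤ} {l : List (ZMod 2 × ℤ)}
    {e : ZMod 2 × ℤ} (he : e = (0, (n : ℤ)))
    (h : ∀ w : ZMod 2 × ZMod n, w ∈ (((x :: l).zip (l ++ [x])).map fun p => p.1 + p.2).map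
      (Prod.map id Int.cast)) (w : ZMod 2 × ℤ) :
    ∃ u v, CyclicallyLinked (x :: l) u v ∧ ∃ k : ℤ, w = u + v + k • e := by
  obtain ⟨_, hs, k, rfl⟩ := exists_mem_eq_add_zsmul he h w
  obtain ⟨⟨u, v⟩, huv, rfl⟩ := List.mem_map.1 hs
  exact ⟨u, v, cyclicallyLinked_of_mem_zip huv, k, rfl⟩

theorem isDoublingCycle_two_four : IsDoublingCycle (M := ZMod 2 × ℤ) (0, 4)
    [(0, 0), (0, 2), (0, 3), (1, 4), (0, 1), (1, 7), (1, 1), (1, 2)]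
    [(0, 4), (1, 8), (1, 6), (1, 11), (0, 6), (1, 5), (0, 5), (0, 7)] (0, 0) (1, 2) (0, 7) where
  perm := by decide
  left := ⟨rfl, rfl⟩
  right := ⟨rfl, rfl⟩
  mem := exists_mem_eq_add_zsmul (n := 8) rfl (by decide)
  sum := exists_cyclicallyLinked_eq_add_zsmul (n := 8) rfl (by decide)

theorem exists_isDoublingCycle (n : ℕ) : ∃ (T S : List (ZMod 2 × ℤ)) (y z : ZMod 2 × ℤ),
    IsDoublingCycle (0, 2 ^ (n + 2))
      ([(0, 0), (0, 2), (0, 3), (1, 4), (0, 1), (1, 7), (1, 1), (1, 2)] ++ T) S (0, 0) y z ∧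
      T.length + 8 = 2 ^ (n + 3) := by
  induction n with
  | zero => exact ⟨[], _, _, _, isDoublingCycle_two_four, rfl⟩
  | succ n ih =>
    obtain ⟨T, S, y, z, h, length_T⟩ := ih
    have length_S := h.perm.length_eq
    simp only [List.length_map, List.length_append, List.length_cons, List.length_nil] at length_S
    have double := h.double
    rw [List.append_assoc, Prod.smul_mk, smul_zero, two_nsmul, ← two_mul, ← pow_succ'] at double
    refine ⟨T ++ S, _, _, _, double, ?_⟩
    rw [List.length_append, length_S, pow_succ]
    omega

theorem Switch.nonempty_of_isHarmonicCycle_map {A : Type*} [AddCommGroup A] [Finite A]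
    {T : List (ZMod 2 × ℤ)} (π : ZMod 2 × ℤ →+ A)
    (cycle : IsHarmonicCycle (([(0, 0), (0, 2), (0, 3), (1, 4)] ++
      ([(0, 1), (1, 7), (1, 1)] ++ (1, 2) :: T)).map π)) : Nonempty (Switch A) := by
  rw [List.map_append, List.map_append] at cycle
  obtain ⟨w, right⟩ := HasEnds.cons (1, 2) T
  have left : HasEnds [((0, 1) : ZMod 2 × ℤ), (1, 7), (1, 1)] (0, 1) (1, 1) := ⟨rfl, rfl⟩
  have front : HasEnds [((0, 0) : ZMod 2 × ℤ), (0, 2), (0, 3), (1, 4)] (0, 0) (1, 4) := ⟨rfl, rfl⟩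
  have rotated := cycle.append_comm (front.map π) ((left.map π).append (right.map π))
  rw [List.append_assoc] at rotated
  exact ⟨{
    X := [(0, 1), (1, 7), (1, 1)].map π
    Y := ((1, 2) :: T).map π ++ [(0, 0), (0, 2), (0, 3), (1, 4)].map π
    a := π (0, 2)
    a' := π (0, 3)
    b := π (1, 4)
    b' := π (0, 1)
    c := π (1, 1)
    c' := π (1, 2)
    cycle := rotated
    left := left.map π
    right := (right.map π).append (front.map π)
    linked := .inr (.inl ((List.infix_append [π (0, 0)] _ [π (1, 4)]).trans
      (List.suffix_append _ _).isInfix))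
    nodup := cycle.nodup.sublist (by simp)
    b_add_c := by rw [← map_add, ← map_add]; rfl
    a_add_b' := by rw [← map_add, ← map_add]; rfl }⟩

theorem Switch.nonempty_two_two_pow (n : ℕ) : Nonempty (Switch (ZMod 2 × ZMod (2 ^ (n + 3)))) := by
  obtain ⟨T, S, y, z, h, length_T⟩ := exists_isDoublingCycle n
  let π : ZMod 2 × ℤ →+ ZMod 2 × ZMod (2 ^ (n + 3)) :=
    (AddMonoidHom.id (ZMod 2)).prodMap (Int.castAddHom (ZMod (2 ^ (n + 3))))
  have hπ : Function.Surjective π := Function.surjective_id.prodMap ZMod.intCast_surjective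
  have map_eq_zero : π (2 • (0, 2 ^ (n + 2))) = 0 := by
    refine Prod.ext rfl ?_
    change ((2 • 2 ^ (n + 2) : ℤ) : ZMod (2 ^ (n + 3))) = 0
    rw [two_nsmul, ← two_mul, ← pow_succ']
    exact_mod_cast ZMod.natCast_self (2 ^ (n + 3))
  have cycle := h.isHarmonicCycle_map hπ map_eq_zero (by simp [← length_T])
  exact nonempty_of_isHarmonicCycle_map (T := T ++ S) π (by simpa using cycle)

theorem hasEnds_range' (i n : ℕ) : HasEnds (List.range' i (n + 1)) i (i + n) := by
  simpa only [List.flatMap_singleton'] using hasEnds_flatMap_range' HasEnds.singleton i n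

theorem isHarmonicCycle_range {n : ℕ} (hn : Odd n) :
    IsHarmonicCycle ((List.range' 0 n).map (Nat.cast : ℕ → ZMod n)) where
  length_eq := by rw [List.length_map, List.length_range', Nat.card_zmod]
  mem x := by
    have : NeZero n := ⟨hn.pos.ne'⟩
    exact List.mem_map.2 ⟨x.val, List.mem_range'_1.2 ⟨x.val.zero_le, by simpa using x.val_lt⟩,
      ZMod.natCast_zmod_val x⟩
  sum y := by
    have : NeZero n := ⟨hn.pos.ne'⟩
    obtain ⟨h, rfl⟩ := hn
    have natCast_eq_zero : 2 * (h : ZMod (2 * h + 1)) + 1 = 0 := by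
      exact_mod_cast ZMod.natCast_self (2 * h + 1)
    -- `h + 1` is the inverse of `2`
    obtain ⟨i, hi, i_eq⟩ : ∃ i < 2 * h + 1, (i : ZMod (2 * h + 1)) = (y - 1) * (h + 1) :=
      ⟨_, ZMod.val_lt _, ZMod.natCast_zmod_val _⟩
    refine ⟨(i : ℕ), (i + 1 : ℕ), ?_, ?_⟩
    · obtain hi | rfl : i + 1 < 2 * h + 1 ∨ i = 2 * h := by omega
      · exact .inl (Linked.map _ (.inl (pair_infix_range' i.zero_le (by omega))))
      · refine .inr (.inr ?_)
        have ends := (hasEnds_range' 0 (2 * h)).map (Nat.cast : ℕ → ZMod (2 * h + 1))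
        rwa [Nat.zero_add, Nat.cast_zero, ← ZMod.natCast_self (2 * h + 1)] at ends
    · push_cast
      rw [i_eq]
      linear_combination (y - 1) * natCast_eq_zero

-- Cutting the cycle `0, 1, …, n - 1` after `k` forces `a = 2 * k + 1` and `a' = l`, and these are
-- consecutive precisely if `l = 2 * k` or `l = 2 * k + 2`, which determines `k` from `n`.
theorem Switch.nonempty_zmod_add {k l : ℕ} (odd : Odd (k + 1 + (l + 1))) (hk : 1 ≤ k)
    (hl : l = 2 * k + 2 ∨ 2 ≤ k ∧ l = 2 * k) :
    Nonempty (Switch (ZMod (k + 1 + (l + 1)))) := by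
  have linked : Linked (List.range' (k + 1) (l + 1)) (2 * k + 1) l := by
    rcases hl with rfl | ⟨-, rfl⟩
    · exact .inl (pair_infix_range' (by omega) (by omega))
    · exact .inr (pair_infix_range' (by omega) (by omega))
  have nodup : [2 * k + 1, l, k + 1 + l, 0, k, k + 1].Nodup := by
    simp only [List.nodup_cons, List.mem_cons, List.not_mem_nil, List.nodup_nil, or_false,
      not_false_eq_true, and_true]
    omega
  have mem_Iio : ∀ i ∈ [2 * k + 1, l, k + 1 + l, 0, k, k + 1], i < k + 1 + (l + 1) := by
    intro i hi
    simp only [List.mem_cons, List.not_mem_nil, or_false] at hi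
    omega
  exact ⟨{
    X := (List.range' 0 (k + 1)).map Nat.cast
    Y := (List.range' (k + 1) (l + 1)).map Nat.cast
    a := (2 * k + 1 : ℕ)
    a' := l
    b := (k + 1 + l : ℕ)
    b' := (0 : ℕ)
    c := k
    c' := (k + 1 : ℕ)
    cycle := by
      rw [← List.map_append]
      convert isHarmonicCycle_range odd
      simpa only [Nat.zero_add] using List.range'_append_1 (s := 0)
    left := by simpa only [Nat.zero_add] using (hasEnds_range' 0 k).map Nat.cast
    right := (hasEnds_range' (k + 1) l).map Nat.cast
    linked := .inr (linked.map Nat.cast)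
    nodup := nodup.map_on fun i hi j hj =>
      CharP.natCast_injOn_Iio (ZMod (k + 1 + (l + 1))) _ (mem_Iio i hi) (mem_Iio j hj)
    b_add_c := by push_cast; ring
    a_add_b' := by push_cast; ring }⟩

theorem Switch.nonempty_zmod {n : ℕ} (odd : Odd n) (seven_le : 7 ≤ n) (three_not_dvd : ¬3 ∣ n) :
    Nonempty (Switch (ZMod n)) := by
  obtain ⟨k, l, rfl, hk, hl⟩ : ∃ k l, n = k + 1 + (l + 1) ∧ 1 ≤ k ∧
      (l = 2 * k + 2 ∨ 2 ≤ k ∧ l = 2 * k) := by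
    rcases (by omega : n % 3 = 1 ∨ n % 3 = 2) with h | h
    · exact ⟨n / 3 - 1, n - n / 3 - 1, by omega⟩
    · exact ⟨n / 3, n - n / 3 - 2, by omega⟩
  exact nonempty_zmod_add odd hk hl

section TwoGroups

variable {ι : Type*} {e : ι → ℕ} {i j k l : ι}

theorem card_pi_zmod_two_pow [Fintype ι] (e : ι → ℕ) :
    Nat.card (∀ i, ZMod (2 ^ e i)) = 2 ^ ∑ i, e i := by
  simp only [Nat.card_pi, Nat.card_zmod, Finset.prod_pow_eq_pow_sum]

theorem add_self_eq_zero_of_castHom_eq_zero {m n : ℕ} (hmn : m ≤ n) (hnm : n ≤ m + 1)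
    {x : ZMod (2 ^ n)} (hx : ZMod.castHom (pow_dvd_pow 2 hmn) (ZMod (2 ^ m)) x = 0) :
    x + x = 0 := by
  obtain ⟨r, rfl⟩ := ZMod.intCast_surjective x
  rw [map_intCast, ZMod.intCast_zmod_eq_zero_iff_dvd] at hx
  rw [← two_mul, ← Int.cast_two, ← Int.cast_mul, ZMod.intCast_zmod_eq_zero_iff_dvd]
  refine (Int.natCast_dvd_natCast.2 (pow_dvd_pow 2 hnm)).trans ?_
  rw [pow_succ', Nat.cast_mul]
  exact mul_dvd_mul_left _ hx

theorem Switch.nonempty_pi_of_le [Fintype ι] {e e' : ι → ℕ} (le : ∀ i, e' i ≤ e i)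
    (le_add_one : ∀ i, e i ≤ e' i + 1) (sum_add_two : ∑ i, e' i + 2 = ∑ i, e i)
    (h : Nonempty (Switch (∀ i, ZMod (2 ^ e' i)))) : Nonempty (Switch (∀ i, ZMod (2 ^ e i))) := by
  let φ : (∀ i, ZMod (2 ^ e i)) →+ ∀ i, ZMod (2 ^ e' i) := AddMonoidHom.piMap fun i =>
    (ZMod.castHom (pow_dvd_pow 2 (le i)) (ZMod (2 ^ e' i))).toAddMonoidHom
  have hφ : Function.Surjective φ := Function.Surjective.piMap fun i =>
    ZMod.castHom_surjective (pow_dvd_pow 2 (le i))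
  have card_ker : Nat.card φ.ker = 4 := by
    have card_mul := φ.ker.index_mul_card
    rw [AddSubgroup.index_ker, AddMonoidHom.range_eq_top.2 hφ, AddSubgroup.card_top,
      card_pi_zmod_two_pow, card_pi_zmod_two_pow, ← sum_add_two, pow_add] at card_mul
    exact Nat.eq_of_mul_eq_mul_left (by positivity) card_mul
  refine nonempty_of_surjective hφ (fun x hx => funext fun i => ?_) card_ker.ge h
  exact add_self_eq_zero_of_castHom_eq_zero (le i) (le_add_one i) (congrFun hx i)

/-- Some factor of `∏ ZMod (2 ^ e i)` has order at least `4` and some other factor is nontrivial: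
the product is neither cyclic nor elementary. -/
def IsMixed (e : ι → ℕ) : Prop := ∃ i j, i ≠ j ∧ 1 ≤ e i ∧ 2 ≤ e j

/-- The exponents `e` with those at `k` and `l` lowered by one: two nontrivial factors of
`∏ ZMod (2 ^ e i)` have been divided by their subgroups of order two. -/
def decrement [DecidableEq ι] (e : ι → ℕ) (k l : ι) : ι → ℕ :=
  fun i => if i = k ∨ i = l then e i - 1 else e i

/-- Two factors can be halved in such a way that the product remains mixed. -/
def IsReducible [DecidableEq ι] (e : ι → ℕ) : Prop :=
  ∃ k l, k ≠ l ∧ 1 ≤ e k ∧ 1 ≤ e l ∧ IsMixed (decrement e k l)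

theorem sum_decrement_add_two [Fintype ι] [DecidableEq ι] (hkl : k ≠ l) (hk : 1 ≤ e k)
    (hl : 1 ≤ e l) : ∑ i, decrement e k l i + 2 = ∑ i, e i := by
  have sum_eq : ∑ i, (if i = k ∨ i = l then 1 else 0) = 2 := by
    rw [← Finset.card_filter, ← Finset.card_pair hkl]
    congr 1
    ext i
    simp only [Finset.mem_filter_univ, Finset.mem_insert, Finset.mem_singleton]
  rw [← sum_eq, ← Finset.sum_add_distrib]
  refine Finset.sum_congr rfl fun i _ => ?_
  grind [decrement]

theorem isReducible_or_of_pair [DecidableEq ι] (hij : i ≠ j) (hi : 1 ≤ e i) (hj : 2 ≤ e j) :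
    IsReducible e ∨ e i = 1 ∨ e i = 2 ∧ e j = 2 := by
  by_contra! h
  obtain ⟨hred, hi1, h22⟩ := h
  by_cases hj3 : 3 ≤ e j
  · exact hred ⟨i, j, hij, hi, by omega, i, j, hij, by grind [decrement], by grind [decrement]⟩
  · exact hred ⟨i, j, hij, hi, by omega, j, i, hij.symm, by grind [decrement],
      by grind [decrement]⟩

theorem isReducible_or_of_triple [DecidableEq ι] (hij : i ≠ j) (hki : k ≠ i) (hkj : k ≠ j)
    (hi : 1 ≤ e i) (hj : 2 ≤ e j) (hk : 1 ≤ e k) :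
    IsReducible e ∨ (e i = 1 ∧ e k = 1 ∧ e j = 2) ∧ ∀ l, l ≠ i → l ≠ k → l ≠ j → e l = 0 := by
  by_contra! h
  obtain ⟨hred, h112⟩ := h
  by_cases hj3 : 3 ≤ e j
  · exact hred ⟨i, j, hij, hi, by omega, k, j, hkj, by grind [decrement], by grind [decrement]⟩
  by_cases hi2 : 2 ≤ e i
  · exact hred ⟨i, k, hki.symm, hi, hk, i, j, hij, by grind [decrement], by grind [decrement]⟩
  by_cases hk2 : 2 ≤ e k
  · exact hred ⟨i, k, hki.symm, hi, hk, k, j, hkj, by grind [decrement], by grind [decrement]⟩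
  obtain ⟨l, hli, hlk, hlj, hl⟩ := h112 ⟨by omega, by omega, by omega⟩
  exact hred ⟨i, k, hki.symm, hi, hk, l, j, hlj, by grind [decrement], by grind [decrement]⟩

theorem bijective_eval_prod_eval {M : ι → Type*} [∀ i, AddCommGroup (M i)] (hij : i ≠ j)
    (subsingleton : ∀ l, l ≠ i → l ≠ j → Subsingleton (M l)) :
    Function.Bijective ((Pi.evalAddMonoidHom M i).prod (Pi.evalAddMonoidHom M j)) := by
  classical
  refine ⟨fun x y hxy => funext fun l => ?_, fun ⟨x, y⟩ => ⟨Pi.single i x + Pi.single j y, ?_⟩⟩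
  · obtain ⟨hi, hj⟩ := Prod.ext_iff.1 hxy
    by_cases hli : l = i
    · exact hli ▸ hi
    by_cases hlj : l = j
    · exact hlj ▸ hj
    exact (subsingleton l hli hlj).elim _ _
  · simp [hij, hij.symm]

theorem bijective_eval_prod_eval_prod_eval {M : ι → Type*} [∀ i, AddCommGroup (M i)] (hij : i ≠ j)
    (hki : k ≠ i) (hkj : k ≠ j)
    (subsingleton : ∀ l, l ≠ i → l ≠ k → l ≠ j → Subsingleton (M l)) :
    Function.Bijective ((Pi.evalAddMonoidHom M i).prod
      ((Pi.evalAddMonoidHom M k).prod (Pi.evalAddMonoidHom M j))) := by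
  classical
  refine ⟨fun x y hxy => funext fun l => ?_,
    fun ⟨x, y, z⟩ => ⟨Pi.single i x + Pi.single k y + Pi.single j z, ?_⟩⟩
  · obtain ⟨hi, hkj⟩ := Prod.ext_iff.1 hxy
    obtain ⟨hk, hj⟩ := Prod.ext_iff.1 hkj
    by_cases hli : l = i
    · exact hli ▸ hi
    by_cases hlk : l = k
    · exact hlk ▸ hk
    by_cases hlj : l = j
    · exact hlj ▸ hj
    exact (subsingleton l hli hlk hlj).elim _ _
  · simp [hij, hij.symm, hki, hki.symm, hkj, hkj.symm]

theorem Switch.nonempty_two_two_pow_of_two_le {n : ℕ} (hn : 2 ≤ n) :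
    Nonempty (Switch (ZMod 2 × ZMod (2 ^ n))) := by
  obtain rfl | hn := hn.eq_or_lt
  · exact nonempty_two_four
  · obtain ⟨n, rfl⟩ := Nat.exists_eq_add_of_le' hn
    exact nonempty_two_two_pow n

theorem subsingleton_zmod_two_pow {n : ℕ} (hn : n = 0) : Subsingleton (ZMod (2 ^ n)) := by
  rw [hn, pow_zero]
  infer_instance

theorem Switch.nonempty_pi_of_not_isReducible [DecidableEq ι] (mixed : IsMixed e)
    (not_reducible : ¬IsReducible e) : Nonempty (Switch (∀ i, ZMod (2 ^ e i))) := by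
  obtain ⟨i, j, hij, hi, hj⟩ := mixed
  by_cases hk : ∃ k, k ≠ i ∧ k ≠ j ∧ 1 ≤ e k
  · obtain ⟨k, hki, hkj, hk⟩ := hk
    obtain ⟨⟨hi1, hk1, hj2⟩, eq_zero⟩ :=
      (isReducible_or_of_triple hij hki hkj hi hj hk).resolve_left not_reducible
    let f := AddEquiv.ofBijective _ (bijective_eval_prod_eval_prod_eval
      (M := fun i => ZMod (2 ^ e i)) hij hki hkj
      fun l hli hlk hlj => subsingleton_zmod_two_pow (eq_zero l hli hlk hlj))
    refine .map (Switch.map f.symm) ?_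
    rw [hi1, hk1, hj2]
    exact nonempty_two_two_four
  · push Not at hk
    let f := AddEquiv.ofBijective _ (bijective_eval_prod_eval (M := fun i => ZMod (2 ^ e i)) hij
      fun l hli hlj => subsingleton_zmod_two_pow (Nat.lt_one_iff.1 (hk l hli hlj)))
    refine .map (Switch.map f.symm) ?_
    rcases (isReducible_or_of_pair hij hi hj).resolve_left not_reducible with hi1 | ⟨hi2, hj2⟩
    · rw [hi1]
      exact nonempty_two_two_pow_of_two_le hj
    · rw [hi2, hj2]
      exact nonempty_four_four

theorem Switch.nonempty_pi [Finite ι] (mixed : IsMixed e) :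
    Nonempty (Switch (∀ i, ZMod (2 ^ e i))) := by
  classical
  have := Fintype.ofFinite ι
  induction hs : ∑ i, e i using Nat.strong_induction_on generalizing e with
  | _ s ih =>
    by_cases reducible : IsReducible e
    · obtain ⟨k, l, hkl, hk, hl, mixed⟩ := reducible
      have sum_eq := sum_decrement_add_two hkl hk hl
      exact nonempty_pi_of_le (fun i => by grind [decrement]) (fun i => by grind [decrement])
        sum_eq (ih _ (by omega) mixed rfl)
    · exact nonempty_pi_of_not_isReducible mixed reducible

theorem Switch.nonempty_of_not_isAddCyclic {P : Type*} [AddCommGroup P] [Finite P] {k : ℕ}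
    (two_pow_smul : ∀ x : P, 2 ^ k • x = 0) (not_cyclic : ¬IsAddCyclic P) {x : P}
    (hx : x + x ≠ 0) : Nonempty (Switch P) := by
  classical
  obtain ⟨ι, _, n, hn, ⟨f⟩⟩ := AddCommGroup.equiv_directSum_zmod_of_finite' P
  replace f := f.trans (DirectSum.addEquivProd fun i => ZMod (n i))
  have exists_eq_two_pow (i) : ∃ e, n i = 2 ^ e := by
    have h := congrFun (map_nsmul f (2 ^ k) (f.symm (Pi.single i 1))) i
    rw [two_pow_smul, map_zero, AddEquiv.apply_symm_apply, Pi.smul_apply, Pi.single_eq_same,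
      nsmul_one, Pi.zero_apply, eq_comm, ZMod.natCast_eq_zero_iff] at h
    obtain ⟨e, -, he⟩ := (Nat.dvd_prime_pow Nat.prime_two).1 h
    exact ⟨e, he⟩
  choose e he using exists_eq_two_pow
  obtain rfl : n = fun i => 2 ^ e i := funext he
  refine .map (Switch.map f.symm) (nonempty_pi ?_)
  obtain ⟨j, hj⟩ : ∃ j, f x j + f x j ≠ 0 := by
    by_contra! h
    exact hx (f.injective (by rw [map_add, map_zero]; exact funext h))
  have two_le : 2 ≤ e j := by
    by_contra! h
    exact hj (add_self_eq_zero_of_castHom_eq_zero (m := 0) (Nat.zero_le _) (by omega)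
      ((subsingleton_zmod_two_pow rfl).elim _ _))
  obtain ⟨i, hij⟩ : ∃ i, i ≠ j := by
    by_contra! h
    refine not_cyclic (isAddCyclic_of_injective
      ((Pi.evalAddMonoidHom _ j).comp f.toAddMonoidHom) fun u v huv => f.injective ?_)
    exact funext fun i => h i ▸ huv
  exact ⟨i, j, hij, Nat.one_le_iff_ne_zero.2 fun h => by simpa [h] using hn i, two_le⟩

end TwoGroups

theorem Switch.nonempty_prod {Q B : Type*} [AddCommGroup Q] [AddCommGroup B] [Finite Q] [Finite B]
    (add_self : ∀ x : Q, x + x = 0) (four_le : 4 ≤ Nat.card Q) (h : Nonempty (Switch B)) :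
    Nonempty (Switch (Q × B)) := by
  refine nonempty_of_surjective (φ := AddMonoidHom.snd Q B) Prod.snd_surjective ?_ ?_ h
  · rintro ⟨x, _⟩ rfl
    exact Prod.ext (add_self x) (add_zero _)
  · refine four_le.trans (Nat.card_le_card_of_injective
      (fun x => (⟨(x, 0), rfl⟩ : (AddMonoidHom.snd Q B).ker)) fun x y hxy => ?_)
    exact congrArg (fun z => z.1.1) hxy

theorem Harmonic.prod_of_two_two_prod {P B : Type*} [AddCommGroup P] [AddCommGroup B] [Finite P]
    [Finite B] (add_self : ∀ x : P, x + x = 0) (four_le : 4 ≤ Nat.card P)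
    (switch : Nonempty (Switch (ZMod 2 × ZMod 2 × B)))
    (harmonic : Harmonic (ZMod 2 × ZMod 2 × ZMod 2 × B)) : Harmonic (P × B) := by
  let _ : Module (ZMod 2) P := AddCommGroup.zmodModule (n := 2) fun x => by rw [two_nsmul, add_self]
  have card_eq : Nat.card P = 2 ^ Module.finrank (ZMod 2) P := by
    rw [Module.natCard_eq_pow_finrank (K := ZMod 2), Nat.card_zmod]
  have two_le : 2 ≤ Module.finrank (ZMod 2) P :=
    (Nat.pow_le_pow_iff_right one_lt_two).1 (card_eq ▸ four_le)
  obtain ⟨d, hd⟩ := Nat.exists_eq_add_of_le' two_le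
  obtain rfl | rfl | ⟨k, rfl⟩ : d = 0 ∨ d = 1 ∨ ∃ k, d = k + 2 := by
    rcases d with _ | _ | k <;> simp
  · let f : P ≃ₗ[ZMod 2] ZMod 2 × ZMod 2 := LinearEquiv.ofFinrankEq _ _ (by simp [hd])
    obtain ⟨S⟩ := switch
    exact S.harmonic.of_addEquiv
      ((f.toAddEquiv.prodCongr (AddEquiv.refl B)).trans AddEquiv.prodAssoc).symm
  · let f : P ≃ₗ[ZMod 2] ZMod 2 × ZMod 2 × ZMod 2 := LinearEquiv.ofFinrankEq _ _ (by simp [hd])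
    exact harmonic.of_addEquiv ((f.toAddEquiv.prodCongr (AddEquiv.refl B)).trans
      (AddEquiv.prodAssoc.trans ((AddEquiv.refl _).prodCongr AddEquiv.prodAssoc))).symm
  · let f : P ≃ₗ[ZMod 2] (Fin (k + 2) → ZMod 2) × ZMod 2 × ZMod 2 :=
      LinearEquiv.ofFinrankEq _ _ (by simp [hd])
    have four_le' : 4 ≤ Nat.card (Fin (k + 2) → ZMod 2) := by
      rw [Nat.card_fun, Nat.card_zmod, Nat.card_fin, pow_add]
      exact Nat.le_mul_of_pos_left 4 (Nat.two_pow_pos k)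
    obtain ⟨S⟩ := Switch.nonempty_prod
      (fun x => funext fun i => CharTwo.add_self_eq_zero (x i)) four_le' switch
    exact S.harmonic.of_addEquiv ((f.toAddEquiv.prodCongr (AddEquiv.refl B)).trans
      (AddEquiv.prodAssoc.trans ((AddEquiv.refl _).prodCongr AddEquiv.prodAssoc))).symm

theorem Harmonic.prod_zmod {P : Type*} [AddCommGroup P] [Finite P] {p : ℕ} (prime : p.Prime)
    (ne_two : p ≠ 2) (add_self : ∀ x : P, x + x = 0) (four_le : 4 ≤ Nat.card P) :
    Harmonic (P × ZMod p) := by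
  have : NeZero p := ⟨prime.ne_zero⟩
  obtain rfl | h3 := eq_or_ne p 3
  · exact prod_of_two_two_prod add_self four_le Switch.nonempty_two_two_three
      isHarmonicCycle_two_two_two_three.harmonic
  obtain rfl | h5 := eq_or_ne p 5
  · exact prod_of_two_two_prod add_self four_le Switch.nonempty_two_two_five
      isHarmonicCycle_two_two_two_five.harmonic
  have odd : Odd p := prime.odd_of_ne_two ne_two
  have seven_le : 7 ≤ p := by
    obtain ⟨s, rfl⟩ := odd
    have := prime.two_le
    omega
  have three_not_dvd : ¬3 ∣ p := fun h =>
    h3 ((Nat.prime_dvd_prime_iff_eq Nat.prime_three prime).1 h).symm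
  obtain ⟨S⟩ := Switch.nonempty_prod add_self four_le
    (Switch.nonempty_zmod odd seven_le three_not_dvd)
  exact S.harmonic

theorem exists_injective_zmod_addMonoidHom {A : Type*} [AddCommGroup A] [Finite A] {p : ℕ}
    [Fact p.Prime] (dvd : p ∣ Nat.card A) : ∃ g : ZMod p →+ A, Function.Injective g := by
  obtain ⟨w, rfl⟩ := exists_prime_addOrderOf_dvd_card' p dvd
  refine ⟨ZMod.lift _ ⟨zmultiplesHom A w, ?_⟩, (ZMod.lift_injective _).2 fun m hm => ?_⟩
  · rw [zmultiplesHom_apply, natCast_zsmul, addOrderOf_nsmul_eq_zero]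
  · rw [zmultiplesHom_apply] at hm
    rwa [ZMod.intCast_zmod_eq_zero_iff_dvd, addOrderOf_dvd_iff_zsmul_eq_zero]

theorem exists_injective_prod_zmod_addMonoidHom {A : Type*} [AddCommGroup A] [Finite A]
    {K : AddSubgroup A} (add_self : ∀ x ∈ K, x + x = 0) {p : ℕ} [Fact p.Prime] (ne_two : p ≠ 2)
    (dvd : p ∣ Nat.card A) : ∃ f : K × ZMod p →+ A, Function.Injective f := by
  obtain ⟨g, hg⟩ := exists_injective_zmod_addMonoidHom dvd
  refine ⟨K.subtype.coprod g, (injective_iff_map_eq_zero _).2 ?_⟩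
  rintro ⟨x, j⟩ hxj
  replace hxj : (x : A) + g j = 0 := hxj
  have two_mul_eq_zero : 2 * j = 0 := by
    refine (map_eq_zero_iff g hg).1 ?_
    rw [two_mul, map_add, eq_neg_of_add_eq_zero_right hxj, ← neg_add, add_self x x.2, neg_zero]
  have two_ne_zero : (2 : ZMod p) ≠ 0 := Ring.two_ne_zero (by rwa [ZMod.ringChar_zmod_n])
  obtain rfl := (mul_eq_zero.1 two_mul_eq_zero).resolve_left two_ne_zero
  rw [map_zero, add_zero] at hxj
  exact Prod.ext (Subtype.ext hxj) rfl

theorem Harmonic.of_elementary_ker {A B : Type*} [AddCommGroup A] [AddCommGroup B] [Finite A]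
    (φ : A →+ B) (hφ : Function.Surjective φ) (odd : Odd (Nat.card B)) (card_ne : Nat.card B ≠ 1)
    (add_self : ∀ x ∈ φ.ker, x + x = 0) (four_le : 4 ≤ Nat.card φ.ker) : Harmonic A := by
  obtain ⟨p, prime, dvd⟩ := Nat.exists_prime_and_dvd card_ne
  have : Fact p.Prime := ⟨prime⟩
  have ne_two : p ≠ 2 := by
    rintro rfl
    exact Nat.not_even_iff_odd.2 odd (even_iff_two_dvd.2 dvd)
  have card_eq : Nat.card A = Nat.card B * Nat.card φ.ker :=
    card_eq_card_mul_card_of_exact φ.ker.subtype_injective (fun x => by simp) hφ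
  obtain ⟨f, hf⟩ :=
    exists_injective_prod_zmod_addMonoidHom add_self ne_two (card_eq ▸ dvd.mul_right _)
  have ker_mk' := QuotientAddGroup.ker_mk' f.range
  refine of_ker_of_odd_card (QuotientAddGroup.mk' f.range) (QuotientAddGroup.mk'_surjective _) ?_ ?_
  · rw [ker_mk']
    exact (prod_zmod prime ne_two (fun x => Subtype.ext (add_self x x.2)) four_le).of_addEquiv
      (AddMonoidHom.ofInjective hf)
  · have card_eq' : Nat.card A = Nat.card (A ⧸ f.range) * Nat.card (φ.ker × ZMod p) :=
      card_eq_card_mul_card_of_exact hf (fun x => by simp) (QuotientAddGroup.mk'_surjective _)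
    rw [card_eq, Nat.card_prod, mul_left_comm, mul_comm] at card_eq'
    have h := Nat.eq_of_mul_eq_mul_left (by omega) card_eq'
    exact (Nat.odd_mul.1 (h ▸ odd)).1

theorem exists_odd_card_range_nsmul (A : Type*) [AddCommGroup A] [Finite A] :
    ∃ k, Odd (Nat.card (nsmulAddMonoidHom (α := A) (2 ^ (k + 1))).range) := by
  obtain ⟨k, m, odd, card_eq⟩ := Nat.exists_eq_two_pow_mul_odd (n := Nat.card A) Nat.card_pos.ne'
  refine ⟨k, ?_⟩
  by_contra h
  rw [Nat.not_odd_iff_even, even_iff_two_dvd] at h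
  obtain ⟨⟨_, x, rfl⟩, hx⟩ := exists_prime_addOrderOf_dvd_card' 2 h
  have smul_eq_zero : m • 2 ^ (k + 1) • x = 0 := by
    rw [smul_smul, pow_succ', mul_left_comm, mul_comm m, ← card_eq, mul_smul, card_nsmul_eq_zero',
      smul_zero]
  have dvd : 2 ∣ m := hx ▸ addOrderOf_dvd_of_nsmul_eq_zero (Subtype.ext smul_eq_zero)
  exact Nat.not_even_iff_odd.2 odd (even_iff_two_dvd.2 dvd)

theorem Harmonic.of_injective_two_two {A : Type*} [AddCommGroup A] [Finite A]
    {ι : ZMod 2 × ZMod 2 →+ A} (hι : Function.Injective ι) {x : A} (hx : x + x ≠ 0) :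
    Harmonic A := by
  obtain ⟨k, odd⟩ := exists_odd_card_range_nsmul A
  let φ := (nsmulAddMonoidHom (α := A) (2 ^ (k + 1))).rangeRestrict
  have hφ : Function.Surjective φ := AddMonoidHom.rangeRestrict_surjective _
  have mem_ker (y : A) : y ∈ φ.ker ↔ 2 ^ (k + 1) • y = 0 := by
    rw [AddMonoidHom.ker_rangeRestrict]
    rfl
  let κ : ZMod 2 × ZMod 2 →+ φ.ker := ι.codRestrict φ.ker fun z => by
    rw [mem_ker, ← map_nsmul, pow_succ, mul_smul, two_nsmul, CharTwo.add_self_eq_zero, smul_zero,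
      map_zero]
  have hκ : Function.Injective κ := fun z w h => hι (congrArg Subtype.val h)
  by_cases elementary : ∀ y ∈ φ.ker, y + y = 0
  · refine of_elementary_ker φ hφ odd (fun h => hx (elementary x ?_)) elementary ?_
    · have := (Nat.card_eq_one_iff_unique.1 h).1
      exact AddMonoidHom.mem_ker.2 (Subsingleton.elim _ _)
    · rw [← IsAddKleinFour.card_four (G := ZMod 2 × ZMod 2)]
      exact Nat.card_le_card_of_injective κ hκ
  · push Not at elementary
    obtain ⟨y, hy, y_add_y⟩ := elementary
    have not_cyclic : ¬IsAddCyclic φ.ker := fun _ =>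
      IsAddKleinFour.not_isAddCyclic (isAddCyclic_of_injective κ hκ)
    obtain ⟨S⟩ := Switch.nonempty_of_not_isAddCyclic (P := φ.ker) (x := ⟨y, hy⟩)
      (fun z => Subtype.ext ((mem_ker z).1 z.2)) not_cyclic
      fun h => y_add_y (congrArg Subtype.val h)
    exact of_ker_of_odd_card φ hφ S.harmonic odd

theorem Harmonic.of_cycleCondition {A : Type*} [AddCommGroup A] [Finite A]
    (h : CycleCondition A (Nat.card A)) : Harmonic A := by
  rcases h with odd | ⟨-, s, two_le, K, ⟨f⟩⟩
  · exact of_odd_card A odd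
  have : NeZero (2 * s) := ⟨by omega⟩
  obtain ⟨g, hg⟩ := exists_injective_zmod_addMonoidHom (A := ZMod (2 * s)) (p := 2) (by simp)
  have hf : Function.Injective (K.subtype.comp f.symm.toAddMonoidHom) :=
    K.subtype_injective.comp f.symm.injective
  refine of_injective_two_two (ι := (K.subtype.comp f.symm.toAddMonoidHom).comp
    ((AddMonoidHom.id (ZMod 2)).prodMap g)) (x := K.subtype.comp f.symm.toAddMonoidHom (0, 1))
    (hf.comp (Function.injective_id.prodMap hg)) fun h => ?_
  rw [← map_add, map_eq_zero_iff _ hf] at h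
  have two_eq_zero : ((2 : ℕ) : ZMod (2 * s)) = 0 := by
    rw [← one_add_one_eq_two, Nat.cast_add, Nat.cast_one]
    exact congrArg Prod.snd h
  have := Nat.le_of_dvd two_pos ((ZMod.natCast_eq_zero_iff _ _).1 two_eq_zero)
  omega

theorem mainTheorem2 (k n : ℕ) (hn : 3 ≤ n) (Γ : Type*) [AddCommGroup Γ]
    (hΓ : Nat.card Γ = n * (k + 1)) (H : AddSubgroup Γ) (hH : Nat.card H = n)
    (hcond : CycleCondition H n) :
    IsHarmonious (superwheel k n) Γ ∧
      ∃ (h : Fin n → H) (g : Fin k → Γ),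
        IsHarmoniousLabeling (SimpleGraph.cycleGraph n) h ∧
        Set.BijOn (fun j => (QuotientAddGroup.mk (g j) : Γ ⧸ H)) Set.univ {0}ᶜ ∧
        IsHarmoniousLabeling (superwheel k n) (Sum.elim (fun i => (h i : Γ)) g) := by
  have : Finite H := Nat.finite_of_card_ne_zero (by omega)
  have index_eq : H.index = k + 1 := by
    refine Nat.eq_of_mul_eq_mul_right (m := n) (by omega) ?_
    rw [← hH, H.index_mul_card, hΓ, hH, mul_comm]
  obtain ⟨h, hh⟩ := Harmonic.exists_labeling (by omega) hH (.of_cycleCondition (hH.symm ▸ hcond))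
  obtain ⟨g, hg⟩ := exists_coset_representatives H index_eq
  have labeling := isHarmoniousLabeling_superwheel hH hh hg
  exact ⟨⟨_, labeling⟩, h, g, hh, hg, labeling⟩
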